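/- **Setting.** Let $A$ be a nonempty countable alphabet, enumerated in some order. Let $A^{-\mathbb N}$ be the set of pasts $\underline a=\ldots a_{-2}a_{-1}$ and $A^\star$ the set of finite strings. Let $P$ be a kernel: $P(a|\underline a)\ge 0$ and $\sum_{a\in A}P(a|\underline a)=1$ for every past $\underline a$. As conditioning strings are written, in $P(a|v\,w\,\underline z)$ the string $v$ is the most recent part of the past, $w$ precedes it in time and $\underline z$ is the remote past. Put $\alpha(a)=\inf_{\underline z}P(a|\underline z)$ and $\alpha_{-1}=\sum_{a}\alpha(a)$. Assume that $P$ is weakly non-null, i.e. $\alpha_{-1}>0$. **Skeletons.** A context tree $\tau$ is a set of finite or infinite strings, none a proper suffix (most recent part) of another, such that each past $\underline a$ has exactly one suffix $c_\tau(\underline a)$ in $\tau$. It is a skeleton if $\tau=\{\emptyset\}$ or if it is the smallest of all context trees $\sigma$ containing its infinite contexts ($\tau$ is smaller than $\sigma$ if each element of $\sigma$ has a suffix in $\tau$). For a finite $v\in\tau$ and $k\ge 0$ let $$\alpha_k^v=\inf_{w\in A^k}\sum_{a\in A}\inf_{\underline z}P(a|v\,w\,\underline z),\qquad \alpha_k^i=\inf\{\alpha_k^v: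 v\in\tau \text{ finite},\ |v|\le i\}.$$ $P$ is locally continuous with respect to $\tau$ if $\alpha_k^v\to1$ as $k\to\infty$ for each finite $v\in\tau$. **Good skeletons.** Let $(U_i)_{i\in\mathbb Z}$ be i.i.d., uniform on $[0,1[$. Partition $[0,\alpha_{-1}[$ into consecutive intervals of lengths $\alpha(a)$, $a\in A$, in the order of the enumeration. Let $Y_i=a$ if $U_i$ lies in the interval of $a$, and $Y_i=\star$ if $U_i\ge\alpha_{-1}$. Let $c_\tau^n$ be the supremum of $|c_\tau(\cdot)|$ over all pasts obtained from $\ldots Y_{n-1}Y_n$ by replacing the $\star$'s by arbitrary symbols. Let $\bar\theta[0]$ be the supremum of the $i\le0$ such that, for every $j\in\{i,\ldots,0\}$, $Y_j\in A$ or $c_\tau^{j-1}\le j-i$ ($-\infty$ if there is none). The probabilistic skeleton of $P$ is good if $\mathbb E|\bar\theta[0]|<\infty$. **Coalescence times.** An update function for $P$ is a map $F$ from pasts and numbers in $[0,1[$ to $A$ with $\mathbb P(F(\underline a,U_0)=a)=P(a|\underline a)$ for all $a,\underline a$. Let $F_{[k,l]}(\underline a,U_k^l)$ be the symbol at time $l$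 obtained by applying $F$ successively at times $k,\ldots,l$, starting from the past $\underline a$ before time $k$. Let $\theta[m,n]$ be the largest $j\le m$ such that none of the symbols $F_{[j,i]}(\underline a,U_j^i)$, $m\le i\le n$, depends on $\underline a$ ($-\infty$ if there is none), and $\theta[0]=\theta[0,0]$. A random variable $W$ has summable (exponential) tail if $\sum_n\mathbb P(|W|\ge n)<\infty$ (if $\mathbb P(|W|\ge n)$ decays exponentially). A sequence $(c_n)$ of non-negative numbers decays exponentially if $c_n\le Dd^n$ for all $n$, for some $D>0$ and $0<d<1$. **Theorem.** Let $P$ be a weakly non-null kernel that is locally continuous with respect to a skeleton $\tau$ and whose probabilistic skeleton is good. Let $A_0=\alpha_{-1}$ and, for $k\ge1$, $$A_k=\left\{1-(\mathbb E|\bar\theta[0]|+1)\,\mathbb P\!\left(U_0>\alpha_k^{c_\tau^{-1}}\right)\right\}\vee\alpha_{-1}.$$ Then there is an update function $F$ for $P$ such that (i) if $\sum_{k\ge1}\prod_{j=0}^{k-1}A_j=+\infty$, then $\theta[0]$ is a.s. finite; (ii) if $\sum_{k\ge0}(1-A_k)<+\infty$, then $\theta[0]$ has summable tail; (iii) if $\bar\theta[0]$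 has exponential tail and $(1-A_k)_{k\ge0}$ decays exponentially, then $\theta[0]$ has exponential tail. In each of these regimes, coupling from the past with update function $F$ is feasible: $\theta[m,n]$ is a.s. finite for all integers $m\le n$. -/

import Mathlib

open MeasureTheory ProbabilityTheory Filter Topology
open scoped ENNReal

noncomputable section

namespace ChainsInfiniteOrder

universe u

/-- An infinite past `… a₋₂ a₋₁`; the symbol `a₋₍ₙ₊₁₎` is stored at index `n`. -/
abbrev Past (A : Type u) : Type u := ℕ → A

/-- The past `x` followed (in time) by the symbol `a`, which becomes the most recent symbol. -/
def consPast {A : Type u} (a : A) (x : Past A) : Past A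
  | 0 => a
  | n + 1 => x n

/-- A finite string `v₋ₖ … v₋₁` is stored as the list `[v₋₁, …, v₋ₖ]` (most recent symbol first).
`appendPast v z` is the past whose most recent part is `v` and whose older part is `z`. -/
def appendPast {A : Type u} (v : List A) (z : Past A) : Past A := v.foldr consPast z

/-- Finite or infinite strings of past symbols, i.e. the elements of `A^* ∪ A^{-ℕ}`. -/
inductive Str (A : Type u) : Type u
  | fin (v : List A) : Str A
  | inf (x : Past A) : Str A

/-- Length of a string. -/
def Str.length {A : Type u} : Str A → ℕ∞
  | .fin v => (v.length : ℕ∞)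
  | .inf _ => ⊤

/-- `v.IsSuffix w`: the string `v` is the most recent part of the string `w`. -/
def Str.IsSuffix {A : Type u} : Str A → Str A → Prop
  | .fin v, .fin w => v <+: w
  | .fin v, .inf x => ∃ z : Past A, appendPast v z = x
  | .inf _, .fin _ => False
  | .inf x, .inf y => x = y

/-- A context tree: a set of strings such that every past has exactly one element of the set as a
suffix (the set is a partition of the set of pasts), no element being a proper suffix of another
one. -/
structure ContextTree (A : Type u) where
  /-- the set of contexts -/
  contexts : Set (Str A)
  partition : ∀ x : Past A, ∃! v : Str A, v ∈ contexts ∧ v.IsSuffix (.inf x)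
  suffixFree : ∀ v ∈ contexts, ∀ w ∈ contexts, v.IsSuffix w → v = w

/-- The context `c_τ(x)`: the unique element of `τ` that is a suffix of the past `x`. -/
def ContextTree.context {A : Type u} (τ : ContextTree A) (x : Past A) : Str A :=
  (τ.partition x).choose

/-- `τ` is a smaller tree than `σ`: every context of `σ` has a suffix in `τ`. -/
def ContextTree.Smaller {A : Type u} (τ σ : ContextTree A) : Prop :=
  ∀ w ∈ σ.contexts, ∃ v ∈ τ.contexts, v.IsSuffix w

/-- A skeleton: the tree whose only context is the empty string, or a context tree that is the
smallest one among those containing all its contexts of infinite length. -/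
def ContextTree.IsSkeleton {A : Type u} (τ : ContextTree A) : Prop :=
  τ.contexts = {Str.fin []} ∨
    ∀ σ : ContextTree A,
      (∀ x : Past A, Str.inf x ∈ τ.contexts → Str.inf x ∈ σ.contexts) → τ.Smaller σ

/-- A transition probability kernel `P(a | x)` on the alphabet `A`. -/
structure Ker (A : Type u) where
  /-- the number `P(a | x)` -/
  prob : A → Past A → ℝ
  nonneg : ∀ a x, 0 ≤ prob a x
  hasSum_one : ∀ x, HasSum (fun a => prob a x) 1

/-- `α(a) = inf_z P(a | z)`. -/
def Ker.alpha {A : Type u} (P : Ker A) (a : A) : ℝ := ⨅ z : Past A, P.prob a z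

/-- `α₋₁ = ∑ₐ α(a)`. -/
def Ker.alphaMinusOne {A : Type u} (P : Ker A) : ℝ := ∑' a : A, P.alpha a

/-- `α_k^v`, the infimum over the strings `w` of length `k` of `∑ₐ inf_z P(a | v w z)`, where `v` is
the most recent part of the past, `w` comes before it and `z` is the remote past. -/
def Ker.alphaCtx {A : Type u} (P : Ker A) (k : ℕ) (v : List A) : ℝ :=
  ⨅ w : Fin k → A, ∑' a : A, ⨅ z : Past A, P.prob a (appendPast (v ++ List.ofFn w) z)

/-- `α_k^i`, the infimum of `α_k^v` over the finite contexts `v` of `τ` of length at most `i`. -/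
def Ker.alphaLen {A : Type u} (P : Ker A) (τ : ContextTree A) (k : ℕ) (i : ℕ∞) : ℝ :=
  sInf ((fun v => P.alphaCtx k v) '' {v : List A | Str.fin v ∈ τ.contexts ∧ (v.length : ℕ∞) ≤ i})

/-- `P` belongs to `LC(τ)`: `α_k^v → 1` as `k → ∞` for every finite context `v` of `τ`. -/
def Ker.LocallyContinuous {A : Type u} (P : Ker A) (τ : ContextTree A) : Prop :=
  ∀ v : List A, Str.fin v ∈ τ.contexts → Tendsto (fun k => P.alphaCtx k v) atTop (𝓝 1)

/-- Left end point of the interval of `[0, α₋₁[` attached to the symbol `a`; the symbols are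
arranged in the order of their codes. -/
def Ker.leftEnd {A : Type u} [Encodable A] (P : Ker A) (a : A) : ℝ :=
  ∑' b : A, if Encodable.encode b < Encodable.encode a then P.alpha b else 0

open Classical in
/-- The variable `Y` as a function of the value `t ∈ [0,1[` of the uniform variable: the symbol
whose interval contains `t`, and `none` (standing for `⋆`) if `t ≥ α₋₁`. -/
def Ker.symbolY {A : Type u} [Encodable A] (P : Ker A) (t : ℝ) : Option A :=
  if h : ∃ a : A, P.leftEnd a ≤ t ∧ t < P.leftEnd a + P.alpha a then some h.choose else none

/-- The past `Y_{-∞}^n(a)` ending at time `n`: the unknown symbols `⋆` of `Y` are replaced by those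
of `a`. -/
def Ker.filledPast {A : Type u} [Encodable A] (P : Ker A) (U : ℤ → ℝ) (a : ℤ → A) (n : ℤ) : Past A :=
  fun r => (P.symbolY (U (n - r))).getD (a (n - r))

/-- The maximum context length `c_τ^n = sup_a |c_τ(Y_{-∞}^n(a))|`. -/
def Ker.maxCtxLength {A : Type u} [Encodable A] (P : Ker A) (τ : ContextTree A) (U : ℤ → ℝ)
    (n : ℤ) : ℕ∞ :=
  ⨆ a : ℤ → A, (τ.context (P.filledPast U a n)).length

/-- `i` is a good coalescence time for time `m`: `i ≤ m`, and for every `j` from `i` to `m`, either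
`Y_j` is a symbol, or every context at time `j` is decided by `Y_i, …, Y_{j-1}`. -/
def Ker.IsGoodTime {A : Type u} [Encodable A] (P : Ker A) (τ : ContextTree A) (U : ℤ → ℝ)
    (m i : ℤ) : Prop :=
  i ≤ m ∧ ∀ j ∈ Set.Icc i m,
    (∃ a : A, P.symbolY (U j) = some a) ∨ P.maxCtxLength τ U (j - 1) ≤ ((j - i).toNat : ℕ∞)

/-- `|θ̄[0]|`, where `θ̄[0]` is the supremum of the good coalescence times for time `0`
(`⊤` if there is none). -/
def Ker.absThetaBar {A : Type u} [Encodable A] (P : Ker A) (τ : ContextTree A) (U : ℤ → ℝ) : ℕ∞ :=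
  ⨅ (k : ℕ) (_ : P.IsGoodTime τ U 0 (-(k : ℤ))), (k : ℕ∞)

/-- `𝔼|θ̄[0]|`, in `[0, ∞]`. -/
def Ker.meanThetaBar {A : Type u} [Encodable A] {Ω : Type*} [MeasurableSpace Ω] (μ : Measure Ω)
    (U : ℤ → Ω → ℝ) (P : Ker A) (τ : ContextTree A) : ℝ≥0∞ :=
  ∫⁻ ω, (P.absThetaBar τ (fun i => U i ω) : ℝ≥0∞) ∂μ

/-- The probabilistic skeleton of `P` with respect to `τ` is good: `θ̄[0]` has finite mean. -/
def Ker.IsGood {A : Type u} [Encodable A] {Ω : Type*} [MeasurableSpace Ω] (μ : Measure Ω)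
    (U : ℤ → Ω → ℝ) (P : Ker A) (τ : ContextTree A) : Prop :=
  Ker.meanThetaBar μ U P τ < ⊤

/-- The sequence `A₀ = α₋₁`,
`A_k = (1 - (𝔼|θ̄[0]| + 1) ℙ(U₀ > α_k^{c_τ^{-1}})) ∨ α₋₁` for `k ≥ 1`. -/
def Ker.seqA {A : Type u} [Encodable A] {Ω : Type*} [MeasurableSpace Ω] (μ : Measure Ω)
    (U : ℤ → Ω → ℝ) (P : Ker A) (τ : ContextTree A) (k : ℕ) : ℝ :=
  if k = 0 then P.alphaMinusOne
  else
    max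
      (1 - ((Ker.meanThetaBar μ U P τ).toReal + 1) *
        μ.real {ω | P.alphaLen τ k (P.maxCtxLength τ (fun i => U i ω) (-1)) < U 0 ω})
      P.alphaMinusOne

/-- The family `U` of real random variables is i.i.d., uniform on `[0,1[`. -/
structure IsIIDUniform {Ω : Type*} [MeasurableSpace Ω] (μ : Measure Ω) (U : ℤ → Ω → ℝ) : Prop where
  measurable : ∀ i, Measurable (U i)
  law : ∀ i, μ.map (U i) = volume.restrict (Set.Ico (0 : ℝ) 1)
  indep : iIndepFun U μ

/-- `F` is an update function for `P`: if `U₀` is uniform on `[0,1[` then `F(x, U₀)` has law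
`P(· | x)`, for every past `x`. -/
def IsUpdateFunction {A : Type u} (P : Ker A) (F : Past A → ℝ → A) : Prop :=
  ∀ (x : Past A) (a : A), MeasurableSet {t : ℝ | t ∈ Set.Ico (0 : ℝ) 1 ∧ F x t = a} ∧
    volume {t : ℝ | t ∈ Set.Ico (0 : ℝ) 1 ∧ F x t = a} = ENNReal.ofReal (P.prob a x)

/-- The past seen at time `k + n` if the past before time `k` is `x` and the symbols at times
`k, …, k + n - 1` are produced by `F`. -/
def pastAfter {A : Type u} (F : Past A → ℝ → A) (x : Past A) (U : ℤ → ℝ) (k : ℤ) : ℕ → Past A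
  | 0 => x
  | n + 1 => consPast (F (pastAfter F x U k n) (U (k + n))) (pastAfter F x U k n)

/-- The iterate `F_{[k,l]}(x, U_k^l)`, for `k ≤ l`: the symbol produced at time `l` when the
past before time `k` is `x`. -/
def iterF {A : Type u} (F : Past A → ℝ → A) (x : Past A) (U : ℤ → ℝ) (k l : ℤ) : A :=
  F (pastAfter F x U k (l - k).toNat) (U l)

/-- `m - θ[m,n]`, where `θ[m,n]` is the largest `j ≤ m` such that none of the symbols produced at
the times `m, …, n` by starting at time `j` depends on the past before `j` (`⊤` if there is no such
`j`, that is, if `θ[m,n] = -∞`). -/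
def coalescenceLag {A : Type u} (F : Past A → ℝ → A) (U : ℤ → ℝ) (m n : ℤ) : ℕ∞ :=
  ⨅ (k : ℕ) (_ : ∀ i ∈ Set.Icc m n, ∀ x y : Past A,
    iterF F x U (m - k) i = iterF F y U (m - k) i), (k : ℕ∞)

/-- `|θ[0]| = 0 - θ[0,0]`. -/
def absTheta {A : Type u} (F : Past A → ℝ → A) (U : ℤ → ℝ) : ℕ∞ := coalescenceLag F U 0 0

/-- The coupling from the past algorithm with update function `F` is feasible: almost surely, all
the coalescence times `θ[m,n]` are finite. -/
def Feasible {A : Type u} {Ω : Type*} [MeasurableSpace Ω] (μ : Measure Ω) (U : ℤ → Ω → ℝ)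
    (F : Past A → ℝ → A) : Prop :=
  ∀ m n : ℤ, m ≤ n → ∀ᵐ ω ∂μ, coalescenceLag F (fun i => U i ω) m n < ⊤

/-- The sequence `c` decays exponentially fast to zero. -/
def DecaysExponentially (c : ℕ → ℝ) : Prop :=
  ∃ D d : ℝ, 0 < D ∧ 0 < d ∧ d < 1 ∧ ∀ n, c n ≤ D * d ^ n

/-- The tail `n ↦ ℙ(W ≥ n)` of a random variable with values in `{0, 1, …, ∞}`. -/
def tail {Ω : Type*} [MeasurableSpace Ω] (μ : Measure Ω) (W : Ω → ℕ∞) (n : ℕ) : ℝ :=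
  μ.real {ω | (n : ℕ∞) ≤ W ω}

end ChainsInfiniteOrder

end

/-!
The update function divides `[0, 1[` into successive layers: the masses `α(a)` come first, then the
masses that become known when the context `v` of the past is known, and then those that become known
when `1, 2, …` symbols before `v` are known. Local continuity makes the layers exhaust `P(· | x)`
when the context is finite; when it is infinite, the second layer is the whole remaining law. A
variable below `α_k^v` thus produces a symbol that depends on `v` and on `k` more symbols only
(`Ker.update_congr`), and a variable below `α₋₁` produces the symbol `Y` (`Ker.update_of_symbolY`).

Time is read backwards, from `U₀` on, as a sequence of law `unifSeq`. It is cut into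
blocks: the first one ends at the smallest good depth `|θ̄[0]|`, the second one is the first block of
the remaining sequence, and so on. Since `|θ̄[0]|` is a stopping time of this exploration, the blocks
are i.i.d. (`Ker.iIndepFun_block`). Inside a block, all the contexts that matter are decided by the
block itself, so that its symbols are determined by the block and by a random number of symbols
before it, its *demand*. By a union bound over the positions of the block, where the event that a
position belongs to the block is independent of what happens at this position and before, the demand
is at most `k` with probability at least `A_k` (`Ker.seqA_le`).

If none of the first `n` blocks demands more symbols than there are older blocks among them (a
*renewal* at `n`), the `n` blocks are coalesced (`Ker.run_totalLen_congr`). Let `r n` be the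
probability that there is no renewal in `1, …, n` and `u n = ∏_{j < n} ℙ(demand ≤ j)` the probability
of a renewal at `n`. Looking at the oldest block that demands too much gives the renewal equation
`r (n + 1) = ∑_{m ≤ n} (u m - u (m + 1)) r (n - m)` (`measureReal_noRenewal_succ`), equivalently
`∑_{m ≤ n} u m * r (n - m) = 1`. Hence `r → 0` if `∑ u = ∞`, `∑ r < ∞` if `u` is bounded away from
zero, and `r` decays geometrically if moreover `u m - u (m + 1)` does. Wald's identity and Chernoff's
bound convert these facts on the number of blocks into facts on the coalescence time; almost sure
coalescence at each time gives feasibility.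
-/

namespace ChainsInfiniteOrder

/-! ### Consecutive intervals indexed by a well-ordered set -/

section Cells

variable {ι K : Type*} [LinearOrder K] (κ : ι → K) (w : ι → ℝ)

/-- Left end point of the interval attached to `i`, when intervals of lengths `w j` are laid out
consecutively from `0` in the order of the keys `κ j`. -/
noncomputable def cellLeft (i : ι) : ℝ := ∑' j, if κ j < κ i then w j else 0

/-- The interval attached to `i`. -/
def cell (i : ι) : Set ℝ := Set.Ico (cellLeft κ w i) (cellLeft κ w i + w i)

variable {κ w}

lemma summable_ite_of_nonneg (hw : ∀ i, 0 ≤ w i) (hs : Summable w) (p : ι → Prop)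
    [DecidablePred p] : Summable (fun j => if p j then w j else 0) :=
  Summable.of_nonneg_of_le (fun j => by split_ifs <;> simp [hw]) (fun j => by
    split_ifs <;> simp [hw]) hs

lemma cellLeft_nonneg (hw : ∀ i, 0 ≤ w i) (i : ι) : 0 ≤ cellLeft κ w i :=
  tsum_nonneg fun j => by split_ifs <;> simp [hw]

lemma cellLeft_add_le (hw : ∀ i, 0 ≤ w i) (hs : Summable w) {q : ι → Prop} [DecidablePred q] {i : ι}
    (h : ∀ j, κ j < κ i → q j) (hi : q i) :
    cellLeft κ w i + w i ≤ ∑' j, if q j then w j else 0 := by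
  classical
  have h1 : ∑' j, (if j = i then w j else 0) = w i := by
    rw [tsum_eq_single i (fun j hj => by simp [hj])]; simp
  rw [← h1, cellLeft, ← Summable.tsum_add (summable_ite_of_nonneg hw hs _)
    (summable_ite_of_nonneg hw hs _)]
  refine Summable.tsum_le_tsum (fun j => ?_) ((summable_ite_of_nonneg hw hs _).add
    (summable_ite_of_nonneg hw hs _)) (summable_ite_of_nonneg hw hs _)
  by_cases hj : κ j < κ i
  · have : j ≠ i := by rintro rfl; exact lt_irrefl _ hj
    simp [hj, this, h j hj]
  · by_cases hji : j = i
    · subst hji; simp [hi]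
    · simp only [hj, hji, if_false, add_zero]; split_ifs <;> simp [hw]

lemma cellLeft_add_le_cellLeft (hw : ∀ i, 0 ≤ w i) (hs : Summable w) {i j : ι} (h : κ i < κ j) :
    cellLeft κ w i + w i ≤ cellLeft κ w j :=
  cellLeft_add_le hw hs (fun _ hk => hk.trans h) h

lemma cellLeft_add_le_tsum (hw : ∀ i, 0 ≤ w i) (hs : Summable w) (i : ι) :
    cellLeft κ w i + w i ≤ ∑' j, w j := by
  simpa using cellLeft_add_le (κ := κ) (i := i) hw hs (q := fun _ => True)
    (fun _ _ => trivial) trivial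

lemma eq_of_mem_cell (hκ : Function.Injective κ) (hw : ∀ i, 0 ≤ w i) (hs : Summable w) {i j : ι}
    {t : ℝ} (hi : t ∈ cell κ w i) (hj : t ∈ cell κ w j) : i = j := by
  rcases lt_trichotomy (κ i) (κ j) with h | h | h
  · have := cellLeft_add_le_cellLeft hw hs h
    exact absurd (hi.2.trans_le this) (not_lt.2 hj.1)
  · exact hκ h
  · have := cellLeft_add_le_cellLeft hw hs h
    exact absurd (hj.2.trans_le this) (not_lt.2 hi.1)

/-- The intervals cover `[0, ∑ w[`: the first interval that ends beyond `t` contains `t`, because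
its left end point is the supremum of the right end points of the preceding ones. -/
lemma exists_mem_cell [WellFoundedLT K] (hκ : Function.Injective κ) (hw : ∀ i, 0 ≤ w i)
    (hs : Summable w) {t : ℝ} (h0 : 0 ≤ t)
    (ht : t < ∑' j, w j) : ∃ i, t ∈ cell κ w i := by
  classical
  -- a finite family of weights with sum above `t` has a largest key, whose interval ends beyond `t`
  have key : ∀ (p : ι → Prop) [DecidablePred p], t < (∑' j, if p j then w j else 0) →
      ∃ i, p i ∧ t < cellLeft κ w i + w i := by
    intro p _ hp
    obtain ⟨s, hs'⟩ := ((summable_ite_of_nonneg hw hs p).hasSum.eventually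
      (lt_mem_nhds hp)).exists
    have hs'' : t < ∑ j ∈ s.filter p, w j := by rwa [Finset.sum_filter]
    have hne : (s.filter p).Nonempty := by
      by_contra hne
      rw [Finset.not_nonempty_iff_eq_empty] at hne
      rw [hne, Finset.sum_empty] at hs''
      exact absurd hs'' (not_lt.2 h0)
    obtain ⟨i, hi, hmax⟩ := Finset.exists_max_image (s.filter p) κ hne
    refine ⟨i, (Finset.mem_filter.1 hi).2, hs''.trans_le ?_⟩
    rw [← Finset.add_sum_erase _ _ hi, add_comm]
    gcongr
    refine le_trans (le_of_eq (Finset.sum_congr rfl fun j hj => ?_))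
      ((summable_ite_of_nonneg hw hs (fun j => κ j < κ i)).sum_le_tsum ((s.filter p).erase i)
        (fun j _ => by split_ifs <;> simp [hw]))
    rw [Finset.mem_erase] at hj
    rw [if_pos (lt_of_le_of_ne (hmax j hj.2) fun h => hj.1 (hκ h))]
  obtain ⟨i0, -, hi0⟩ := key (fun _ => True) (by simpa using ht)
  obtain ⟨i, hi, hmin⟩ := (InvImage.wf κ (wellFounded_lt (α := K))).has_min
    {i | t < cellLeft κ w i + w i} ⟨i0, hi0⟩
  refine ⟨i, ?_, hi⟩
  by_contra hlt
  rw [not_le] at hlt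
  obtain ⟨j, hj, hj'⟩ := key (fun j => κ j < κ i) hlt
  exact hmin j hj' hj

end Cells

/-! ### The layered choice of a symbol -/

section Layers

variable {A : Type*} {q q' : ℕ → A → ℝ} {p : A → ℝ}

/-- `q 0 ≤ q 1 ≤ …` are nonnegative functions on the alphabet that increase to the probability
vector `p`. -/
structure IsLayering (q : ℕ → A → ℝ) (p : A → ℝ) : Prop where
  nonneg : ∀ a, 0 ≤ q 0 a
  mono : ∀ a, Monotone fun n => q n a
  tendsto : ∀ a, Tendsto (fun n => q n a) atTop (𝓝 (p a))
  hasSum_one : HasSum p 1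

/-- The mass added to the symbol `a` by the layer `n`. -/
def layerWeight (q : ℕ → A → ℝ) : ℕ × A → ℝ
  | (0, a) => q 0 a
  | (n + 1, a) => q (n + 1) a - q n a

lemma IsLayering.layerWeight_nonneg (h : IsLayering q p) (i : ℕ × A) : 0 ≤ layerWeight q i := by
  obtain ⟨_ | n, a⟩ := i
  · exact h.nonneg a
  · exact sub_nonneg.2 (h.mono a n.le_succ)

lemma sum_range_layerWeight (q : ℕ → A → ℝ) (n : ℕ) (a : A) :
    ∑ m ∈ Finset.range (n + 1), layerWeight q (m, a) = q n a := by
  induction n with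
  | zero => simp [layerWeight]
  | succ n ih => rw [Finset.sum_range_succ, ih, layerWeight]; ring

lemma IsLayering.le (h : IsLayering q p) (n : ℕ) (a : A) : q n a ≤ p a :=
  (h.mono a).ge_of_tendsto (h.tendsto a) n

lemma IsLayering.nonneg' (h : IsLayering q p) (n : ℕ) (a : A) : 0 ≤ q n a :=
  (h.nonneg a).trans (h.mono a n.zero_le)

lemma IsLayering.summable (h : IsLayering q p) (n : ℕ) : Summable (q n) :=
  Summable.of_nonneg_of_le (h.nonneg' n) (h.le n) h.hasSum_one.summable

lemma IsLayering.hasSum_layerWeight_right (h : IsLayering q p) (a : A) :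
    HasSum (fun n => layerWeight q (n, a)) (p a) := by
  rw [hasSum_iff_tendsto_nat_of_nonneg (fun n => h.layerWeight_nonneg (n, a)),
    ← tendsto_add_atTop_iff_nat 1]
  simpa only [sum_range_layerWeight] using h.tendsto a

lemma hasSum_of_hasSum_right {g : ℕ × A → ℝ} (hg : ∀ i, 0 ≤ g i) {r : A → ℝ} {c : ℝ}
    (h : ∀ a, HasSum (fun n => g (n, a)) (r a)) (hr : HasSum r c) : HasSum g c := by
  have hs : Summable (fun x : A × ℕ => g x.swap) := by
    rw [summable_prod_of_nonneg (fun x => hg _)]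
    refine ⟨fun a => (h a).summable, ?_⟩
    simpa only [Prod.swap_prod_mk, (h _).tsum_eq] using hr.summable
  have h2 := hs.hasSum
  simp only [hs.tsum_prod' (fun a => (h a).summable), Prod.swap_prod_mk, (h _).tsum_eq,
    hr.tsum_eq] at h2
  exact (Equiv.prodComm A ℕ).hasSum_iff.1 h2

lemma IsLayering.hasSum_layerWeight (h : IsLayering q p) : HasSum (layerWeight q) 1 :=
  hasSum_of_hasSum_right h.layerWeight_nonneg h.hasSum_layerWeight_right h.hasSum_one

lemma IsLayering.tsum_layerWeight_le (h : IsLayering q p) (k : ℕ) :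
    ∑' i : ℕ × A, (if i.1 ≤ k then layerWeight q i else 0) = ∑' a, q k a := by
  refine (hasSum_of_hasSum_right (fun i => ?_) (fun a => ?_) (h.summable k).hasSum).tsum_eq
  · split_ifs
    exacts [h.layerWeight_nonneg i, le_rfl]
  · rw [← sum_range_layerWeight q]
    have h2 : HasSum (fun n => if n ≤ k then layerWeight q (n, a) else 0)
        (∑ n ∈ Finset.range (k + 1), if n ≤ k then layerWeight q (n, a) else 0) :=
      hasSum_sum_of_ne_finset_zero fun n hn => if_neg (by simpa [Nat.lt_succ_iff] using hn)
    rwa [Finset.sum_congr rfl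
      (fun n hn => if_pos (Nat.lt_succ_iff.1 (Finset.mem_range.1 hn)))] at h2

variable [Encodable A]

/-- The order in which the masses `layerWeight q (n, a)` are laid out: layer by layer and, within a
layer, in the order of the codes of the symbols. -/
def layerKey (i : ℕ × A) : ℕ ×ₗ ℕ := toLex (i.1, Encodable.encode i.2)

lemma layerKey_injective : Function.Injective (layerKey (A := A)) := by
  rintro ⟨n, a⟩ ⟨m, b⟩ h
  simp only [layerKey, EmbeddingLike.apply_eq_iff_eq, Prod.mk.injEq] at h
  rw [h.1, Encodable.encode_injective h.2]

lemma layerKey_lt {i j : ℕ × A} : layerKey i < layerKey j ↔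
    i.1 < j.1 ∨ i.1 = j.1 ∧ Encodable.encode i.2 < Encodable.encode j.2 := by
  simp [layerKey, Prod.Lex.toLex_lt_toLex]

open Classical in
/-- The symbol `a` such that `t` lies in one of the intervals of `a`, when the masses
`layerWeight q (n, a)` are laid out in the order of `layerKey`. The value is arbitrary if there is
no such symbol. -/
noncomputable def layerSymbol [Nonempty A] (q : ℕ → A → ℝ) (t : ℝ) : A :=
  if h : ∃ i : ℕ × A, t ∈ cell layerKey (layerWeight q) i then h.choose.2
  else Classical.arbitrary A

variable [Nonempty A]

lemma IsLayering.layerSymbol_eq (h : IsLayering q p) {i : ℕ × A} {t : ℝ}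
    (hi : t ∈ cell layerKey (layerWeight q) i) : layerSymbol q t = i.2 := by
  have hex : ∃ i : ℕ × A, t ∈ cell layerKey (layerWeight q) i := ⟨i, hi⟩
  rw [layerSymbol, dif_pos hex, eq_of_mem_cell layerKey_injective h.layerWeight_nonneg
    h.hasSum_layerWeight.summable hex.choose_spec hi]

lemma IsLayering.layerSymbol_eq_iff (h : IsLayering q p) {t : ℝ} (h0 : 0 ≤ t) (h1 : t < 1) (a : A) :
    layerSymbol q t = a ↔ ∃ n, t ∈ cell layerKey (layerWeight q) (n, a) := by
  obtain ⟨⟨n, b⟩, hb⟩ := exists_mem_cell layerKey_injective h.layerWeight_nonneg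
    h.hasSum_layerWeight.summable h0 (by rwa [h.hasSum_layerWeight.tsum_eq])
  refine ⟨fun ha => ⟨n, ?_⟩, fun ⟨m, hm⟩ => h.layerSymbol_eq hm⟩
  rw [h.layerSymbol_eq hb] at ha
  rwa [← ha]

lemma IsLayering.setOf_layerSymbol_eq (h : IsLayering q p) (a : A) :
    {t : ℝ | t ∈ Set.Ico (0 : ℝ) 1 ∧ layerSymbol q t = a} =
      ⋃ n, cell layerKey (layerWeight q) (n, a) := by
  ext t
  simp only [Set.mem_ofPred_eq, Set.mem_iUnion]
  refine ⟨fun ⟨ht, hta⟩ => (h.layerSymbol_eq_iff ht.1 ht.2 a).1 hta, fun ⟨n, hn⟩ => ?_⟩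
  refine ⟨⟨(cellLeft_nonneg h.layerWeight_nonneg _).trans hn.1, hn.2.trans_le ?_⟩,
    h.layerSymbol_eq hn⟩
  exact (cellLeft_add_le_tsum h.layerWeight_nonneg h.hasSum_layerWeight.summable _).trans_eq
    h.hasSum_layerWeight.tsum_eq

lemma measurableSet_cell {ι K : Type*} [LinearOrder K] (κ : ι → K) (w : ι → ℝ) (i : ι) :
    MeasurableSet (cell κ w i) := measurableSet_Ico

lemma IsLayering.measurableSet_layerSymbol (h : IsLayering q p) (a : A) :
    MeasurableSet {t : ℝ | t ∈ Set.Ico (0 : ℝ) 1 ∧ layerSymbol q t = a} := by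
  rw [h.setOf_layerSymbol_eq]
  exact MeasurableSet.iUnion fun n => measurableSet_cell _ _ _

lemma IsLayering.volume_layerSymbol (h : IsLayering q p) (a : A) :
    volume {t : ℝ | t ∈ Set.Ico (0 : ℝ) 1 ∧ layerSymbol q t = a} = ENNReal.ofReal (p a) := by
  rw [h.setOf_layerSymbol_eq, measure_iUnion ?_ fun n => measurableSet_cell _ _ _]
  · simp only [cell, Real.volume_Ico, add_sub_cancel_left]
    rw [← ENNReal.ofReal_tsum_of_nonneg (fun n => h.layerWeight_nonneg _)
      (h.hasSum_layerWeight_right a).summable, (h.hasSum_layerWeight_right a).tsum_eq]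
  · intro m n hmn
    refine Set.disjoint_left.2 fun t hm hn => hmn ?_
    exact congrArg Prod.fst (eq_of_mem_cell layerKey_injective h.layerWeight_nonneg
      h.hasSum_layerWeight.summable hm hn)

/-- The bottom layer of the construction reproduces the intervals of lengths `q 0 a`. -/
lemma IsLayering.layerSymbol_eq_of_mem_cell_zero (h : IsLayering q p) {a : A} {t : ℝ}
    (ht : t ∈ cell (Encodable.encode (α := A)) (q 0) a) : layerSymbol q t = a := by
  have hl : cellLeft layerKey (layerWeight q) (0, a) =
      cellLeft (Encodable.encode (α := A)) (q 0) a := by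
    have hinj : Function.Injective (fun b : A => ((0, b) : ℕ × A)) := fun b c hbc => by
      simpa using hbc
    rw [cellLeft, cellLeft, ← hinj.tsum_eq]
    · simp [layerKey_lt, layerWeight]
    · rintro ⟨m, b⟩ hb
      rw [Function.mem_support] at hb
      have : m = 0 := by
        by_contra hm
        refine hb (if_neg ?_)
        rw [layerKey_lt]
        simp only
        omega
      exact ⟨b, by simp [this]⟩
  refine h.layerSymbol_eq (i := (0, a)) ?_
  rw [cell, hl]
  exact ht

/-- Below the total mass of the layers `0, …, k`, the chosen symbol depends on these layers only. -/
lemma IsLayering.layerSymbol_congr {p' : A → ℝ} (h : IsLayering q p) (h' : IsLayering q' p') {k : ℕ}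
    (hqq : ∀ m ≤ k, q m = q' m) {t : ℝ} (ht : t < ∑' a, q k a) :
    layerSymbol q t = layerSymbol q' t := by
  have hw : ∀ i : ℕ × A, i.1 ≤ k → layerWeight q i = layerWeight q' i := by
    rintro ⟨_ | n, a⟩ hi
    · simp [layerWeight, hqq 0 hi]
    · simp [layerWeight, hqq (n + 1) hi, hqq n (n.le_succ.trans hi)]
  have hcell : ∀ i : ℕ × A, i.1 ≤ k → cell layerKey (layerWeight q) i =
      cell layerKey (layerWeight q') i := by
    intro i hi
    have : cellLeft layerKey (layerWeight q) i = cellLeft layerKey (layerWeight q') i := by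
      refine tsum_congr fun j => ?_
      split_ifs with hj
      · refine hw j ?_
        rw [layerKey_lt] at hj
        omega
      · rfl
    rw [cell, cell, this, hw i hi]
  rcases lt_or_ge t 0 with h0 | h0
  · have hneg : ∀ {r : ℕ → A → ℝ} {s : A → ℝ}, IsLayering r s →
        layerSymbol r t = Classical.arbitrary A := fun hr =>
      dif_neg fun ⟨i, hi⟩ => absurd (h0.trans_le (cellLeft_nonneg hr.layerWeight_nonneg i))
        (not_lt.2 hi.1)
    rw [hneg h, hneg h']
  · have ht1 : t < 1 := ht.trans_le <| by
      rw [← h.hasSum_one.tsum_eq]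
      exact (h.summable k).tsum_le_tsum (h.le k) h.hasSum_one.summable
    obtain ⟨i, hi⟩ := exists_mem_cell layerKey_injective h.layerWeight_nonneg
      h.hasSum_layerWeight.summable h0 (by rwa [h.hasSum_layerWeight.tsum_eq])
    have hik : i.1 ≤ k := by
      by_contra hik
      have h1 : ∑' j : ℕ × A, (if j.1 ≤ k then layerWeight q j else 0) ≤
          cellLeft layerKey (layerWeight q) i := by
        refine Summable.tsum_le_tsum (fun j => ?_)
          (summable_ite_of_nonneg h.layerWeight_nonneg h.hasSum_layerWeight.summable _)
          (summable_ite_of_nonneg h.layerWeight_nonneg h.hasSum_layerWeight.summable _)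
        split_ifs with hj hj'
        · rfl
        · exact absurd (layerKey_lt.2 (Or.inl (by omega))) hj'
        · exact h.layerWeight_nonneg j
        · rfl
      rw [h.tsum_layerWeight_le] at h1
      exact absurd (ht.trans_le h1) (not_lt.2 hi.1)
    rw [h.layerSymbol_eq hi, h'.layerSymbol_eq (by rwa [← hcell i hik])]

end Layers

/-! ### Contexts and finite parts of pasts -/

section Contexts

variable {A : Type*}

/-- The string of the `l` most recent symbols of the past `x`. -/
def recent (l : ℕ) (x : Past A) : List A := (List.range l).map x

@[simp] lemma length_recent (l : ℕ) (x : Past A) : (recent l x).length = l := by simp [recent]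

lemma recent_congr {l : ℕ} {x y : Past A} (h : ∀ i < l, x i = y i) : recent l x = recent l y :=
  List.map_congr_left fun i hi => h i (List.mem_range.1 hi)

lemma recent_add (l k : ℕ) (x : Past A) :
    recent (l + k) x = recent l x ++ List.ofFn fun i : Fin k => x (l + i) := by
  rw [recent, List.range_add, List.map_append, List.map_map, recent]
  congr 1
  exact List.ext_getElem (by simp) (by simp)

lemma appendPast_append (v w : List A) (z : Past A) :
    appendPast (v ++ w) z = appendPast v (appendPast w z) := by
  simp [appendPast]

lemma appendPast_recent (l : ℕ) (x : Past A) :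
    appendPast (recent l x) (fun n => x (l + n)) = x := by
  induction l with
  | zero => simp [recent, appendPast]
  | succ l ih =>
    rw [recent_add l 1, appendPast_append]
    conv_rhs => rw [← ih]
    congr 1
    funext n
    cases n <;> simp [appendPast, consPast, Nat.add_assoc, Nat.add_comm 1]

lemma recent_appendPast (v : List A) (z : Past A) : recent v.length (appendPast v z) = v := by
  induction v with
  | nil => simp [recent]
  | cons a v ih =>
    rw [List.length_cons, recent, List.range_succ_eq_map, List.map_cons, List.map_map]
    exact congrArg (a :: ·) ih

lemma isSuffix_inf_iff {v : List A} {x : Past A} :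
    (Str.fin v).IsSuffix (.inf x) ↔ recent v.length x = v := by
  constructor
  · rintro ⟨z, rfl⟩
    exact recent_appendPast v z
  · intro h
    refine ⟨fun n => x (v.length + n), ?_⟩
    conv_lhs => rw [← h]
    simpa using appendPast_recent v.length x

lemma ContextTree.context_mem (τ : ContextTree A) (x : Past A) : τ.context x ∈ τ.contexts :=
  (τ.partition x).choose_spec.1.1

lemma ContextTree.context_isSuffix (τ : ContextTree A) (x : Past A) :
    (τ.context x).IsSuffix (.inf x) :=
  (τ.partition x).choose_spec.1.2

lemma ContextTree.context_eq {τ : ContextTree A} {x : Past A} {c : Str A} (hc : c ∈ τ.contexts)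
    (hx : c.IsSuffix (.inf x)) : τ.context x = c :=
  ((τ.partition x).choose_spec.2 c ⟨hc, hx⟩).symm

lemma ContextTree.recent_of_context {τ : ContextTree A} {x : Past A} {v : List A}
    (h : τ.context x = .fin v) : recent v.length x = v :=
  isSuffix_inf_iff.1 (h ▸ τ.context_isSuffix x)

/-- A finite context is shared by all the pasts with the same recent symbols. -/
lemma ContextTree.context_congr {τ : ContextTree A} {x y : Past A} {v : List A}
    (h : τ.context x = .fin v) (hxy : ∀ i < v.length, x i = y i) : τ.context y = .fin v :=
  context_eq (h ▸ τ.context_mem x)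
    (isSuffix_inf_iff.2 ((recent_congr hxy).symm.trans (recent_of_context h)))

end Contexts

/-! ### The update function -/

section Update

variable {A : Type*} (P : Ker A) (τ : ContextTree A)

/-- The infimum of `P(a | y)` over the pasts `y` with the same `l` most recent symbols as `x`. -/
noncomputable def Ker.infProb (l : ℕ) (x : Past A) (a : A) : ℝ :=
  ⨅ z : Past A, P.prob a (appendPast (recent l x) z)

variable {P τ}

lemma Ker.bddBelow_prob {β : Type*} (a : A) (f : β → Past A) :
    BddBelow (Set.range fun z => P.prob a (f z)) :=
  ⟨0, by rintro _ ⟨z, rfl⟩; exact P.nonneg _ _⟩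

lemma Ker.alpha_le (a : A) (x : Past A) : P.alpha a ≤ P.prob a x :=
  ciInf_le (Ker.bddBelow_prob a id) x

lemma Ker.alpha_nonneg (a : A) : 0 ≤ P.alpha a := Real.iInf_nonneg fun _ => P.nonneg _ _

lemma Ker.infProb_nonneg (l : ℕ) (x : Past A) (a : A) : 0 ≤ P.infProb l x a :=
  Real.iInf_nonneg fun _ => P.nonneg _ _

lemma Ker.infProb_le (l : ℕ) (x : Past A) (a : A) : P.infProb l x a ≤ P.prob a x := by
  refine (ciInf_le (Ker.bddBelow_prob a _) (fun n => x (l + n))).trans_eq ?_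
  rw [appendPast_recent]

lemma Ker.summable_infProb (l : ℕ) (x : Past A) : Summable (P.infProb l x) :=
  Summable.of_nonneg_of_le (P.infProb_nonneg l x) (P.infProb_le l x) (P.hasSum_one x).summable

lemma Ker.infProb_congr {l : ℕ} {x y : Past A} (h : ∀ i < l, x i = y i) :
    P.infProb l x = P.infProb l y := by
  funext a
  rw [infProb, infProb, recent_congr h]

lemma Ker.alpha_le_infProb [Nonempty A] (l : ℕ) (x : Past A) (a : A) :
    P.alpha a ≤ P.infProb l x a :=
  le_ciInf fun _ => P.alpha_le _ _

lemma Ker.infProb_mono [Nonempty A] {l m : ℕ} (h : l ≤ m) (x : Past A) (a : A) :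
    P.infProb l x a ≤ P.infProb m x a := by
  obtain ⟨k, rfl⟩ := Nat.exists_eq_add_of_le h
  refine le_ciInf fun z => ?_
  rw [recent_add, appendPast_append]
  exact ciInf_le (Ker.bddBelow_prob a _) _

lemma Ker.alphaCtx_le_tsum_infProb [Nonempty A] {x : Past A} {v : List A}
    (h : recent v.length x = v) (k : ℕ) :
    P.alphaCtx k v ≤ ∑' a, P.infProb (v.length + k) x a := by
  have hb : BddBelow (Set.range fun w : Fin k → A =>
      ∑' a : A, ⨅ z : Past A, P.prob a (appendPast (v ++ List.ofFn w) z)) :=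
    ⟨0, by rintro _ ⟨z, rfl⟩; exact tsum_nonneg fun a => Real.iInf_nonneg fun _ => P.nonneg _ _⟩
  refine (ciInf_le hb fun i : Fin k => x (v.length + i)).trans_eq ?_
  simp only [infProb, recent_add, h]

variable (P τ)

/-- The masses accumulated by the successive layers of the construction of the symbol that follows
the past `x`: first the mass `α(a)`, which does not depend on the past, then the masses known from
the context of `x` and the `0, 1, 2, …` symbols before it. If the context is infinite, the second
layer already completes the whole law `P(· | x)`. -/
noncomputable def Ker.layers (x : Past A) : ℕ → A → ℝ
  | 0 => P.alpha
  | k + 1 => match τ.context x with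
    | .fin v => P.infProb (v.length + k) x
    | .inf _ => fun a => P.prob a x

variable {P τ}

lemma Ker.layers_succ_fin {x : Past A} {v : List A} (h : τ.context x = .fin v) (k : ℕ) :
    P.layers τ x (k + 1) = P.infProb (v.length + k) x := by
  rw [layers, h]

lemma Ker.layers_succ_inf {x y : Past A} (h : τ.context x = .inf y) (k : ℕ) :
    P.layers τ x (k + 1) = fun a => P.prob a x := by
  rw [layers, h]

lemma Ker.tendsto_infProb [Nonempty A] (hLC : P.LocallyContinuous τ) {x : Past A} {v : List A}
    (h : τ.context x = .fin v) (a : A) :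
    Tendsto (fun k => P.infProb (v.length + k) x a) atTop (𝓝 (P.prob a x)) := by
  have h1 : Tendsto (fun k => P.prob a x - (1 - P.alphaCtx k v)) atTop (𝓝 (P.prob a x)) := by
    have h0 := hLC v (h ▸ τ.context_mem x)
    simpa using (tendsto_const_nhds (x := P.prob a x)).sub
      ((tendsto_const_nhds (x := (1 : ℝ))).sub h0)
  refine tendsto_of_tendsto_of_tendsto_of_le_of_le h1 tendsto_const_nhds (fun k => ?_)
    (fun k => P.infProb_le _ x a)
  -- the deficit at `a` is at most the total deficit
  have hs := (P.hasSum_one x).sub (P.summable_infProb (v.length + k) x).hasSum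
  have h2 := le_hasSum hs a fun b _ => sub_nonneg.2 (P.infProb_le _ x b)
  have h3 := P.alphaCtx_le_tsum_infProb (ContextTree.recent_of_context h) k
  simp only
  linarith

lemma Ker.isLayering_layers [Nonempty A] (hLC : P.LocallyContinuous τ) (x : Past A) :
    IsLayering (P.layers τ x) fun a => P.prob a x where
  nonneg := P.alpha_nonneg
  hasSum_one := P.hasSum_one x
  mono a := by
    refine monotone_nat_of_le_succ fun n => ?_
    cases h : τ.context x with
    | fin v =>
      cases n with
      | zero => rw [layers_succ_fin h]; exact P.alpha_le_infProb _ x a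
      | succ n =>
        rw [layers_succ_fin h, layers_succ_fin h]
        exact P.infProb_mono (by omega) x a
    | inf y =>
      cases n with
      | zero => rw [layers_succ_inf h]; exact P.alpha_le a x
      | succ n => rw [layers_succ_inf h, layers_succ_inf h]
  tendsto a := by
    rw [← tendsto_add_atTop_iff_nat 1]
    cases h : τ.context x with
    | fin v => simpa only [layers_succ_fin h] using Ker.tendsto_infProb hLC h a
    | inf y => simpa only [layers_succ_inf h] using tendsto_const_nhds

variable [Encodable A] [Nonempty A]

variable (P τ) in
/-- The update function: the unit interval is divided into the successive layers of `Ker.layers`,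
each of them being divided among the symbols. -/
noncomputable def Ker.update (x : Past A) (t : ℝ) : A := layerSymbol (P.layers τ x) t

lemma Ker.isUpdateFunction_update (hLC : P.LocallyContinuous τ) :
    IsUpdateFunction P (P.update τ) := fun x a =>
  ⟨(P.isLayering_layers hLC x).measurableSet_layerSymbol a,
    (P.isLayering_layers hLC x).volume_layerSymbol a⟩

omit [Nonempty A] in
lemma Ker.mem_cell_of_symbolY {t : ℝ} {a : A} (h : P.symbolY t = some a) :
    t ∈ cell (Encodable.encode (α := A)) P.alpha a := by
  rw [symbolY] at h
  split_ifs at h with hex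
  have := hex.choose_spec
  rw [Option.some.inj h] at this
  exact this

lemma Ker.update_of_symbolY (hLC : P.LocallyContinuous τ) {t : ℝ} {a : A}
    (h : P.symbolY t = some a) (x : Past A) : P.update τ x t = a :=
  (P.isLayering_layers hLC x).layerSymbol_eq_of_mem_cell_zero (mem_cell_of_symbolY h)

/-- Below the level `α_k^v`, where `v` is the context of `x`, the symbol produced depends on `v` and
on the `k` preceding symbols only. -/
lemma Ker.update_congr (hLC : P.LocallyContinuous τ) {x y : Past A} {v : List A} {k : ℕ}
    (h : τ.context x = .fin v) (hxy : ∀ i < v.length + k, x i = y i) {t : ℝ}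
    (ht : t < P.alphaCtx k v) : P.update τ x t = P.update τ y t := by
  have hy := ContextTree.context_congr h fun i hi => hxy i (by omega)
  refine (P.isLayering_layers hLC x).layerSymbol_congr (P.isLayering_layers hLC y) (k := k + 1)
    (fun m hm => ?_) ?_
  · cases m with
    | zero => rfl
    | succ m =>
      rw [layers_succ_fin h, layers_succ_fin hy]
      exact P.infProb_congr fun i hi => hxy i (by omega)
  · rw [layers_succ_fin h]
    exact ht.trans_le (P.alphaCtx_le_tsum_infProb (ContextTree.recent_of_context h) k)

end Update

/-! ### Good blocks read backwards in time -/

section Blocks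

/-- The sequence `u` without its first `n` terms. -/
def shift {β : Type*} (n : ℕ) (u : ℕ → β) : ℕ → β := fun k => u (n + k)

lemma shift_shift {β : Type*} (m n : ℕ) (u : ℕ → β) : shift m (shift n u) = shift (n + m) u := by
  funext k
  simp [shift, Nat.add_assoc]

lemma shift_zero {β : Type*} (u : ℕ → β) : shift 0 u = u := by
  funext k
  simp [shift]

/-- The values of `U` at the times `n, n - 1, n - 2, …`. -/
def backward (U : ℤ → ℝ) (n : ℤ) : ℕ → ℝ := fun r => U (n - r)

lemma shift_backward (U : ℤ → ℝ) (n : ℤ) (k : ℕ) :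
    shift k (backward U n) = backward U (n - k) := by
  funext r
  simp [shift, backward, sub_sub]

variable {A : Type*} [Encodable A] (P : Ker A) (τ : ContextTree A)

/-- The past obtained from the symbols `Y` attached to `u 0, u 1, …` (most recent first), the
unknown symbols being those of `x`. -/
noncomputable def Ker.fill (u : ℕ → ℝ) (x : Past A) : Past A :=
  fun r => (P.symbolY (u r)).getD (x r)

/-- The maximum length of the contexts of the pasts compatible with `u`. -/
noncomputable def Ker.ctxLen (u : ℕ → ℝ) : ℕ∞ := ⨆ x : Past A, (τ.context (P.fill u x)).length

/-- The number `t` is a good depth for `u` if, in each of the positions `0, …, t`, the symbol is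
known or the contexts are decided by the older positions up to `t`. -/
def Ker.IsGoodDepth (u : ℕ → ℝ) (t : ℕ) : Prop :=
  ∀ j ≤ t, (∃ a, P.symbolY (u j) = some a) ∨ P.ctxLen τ (shift (j + 1) u) ≤ ((t - j : ℕ) : ℕ∞)

/-- The smallest good depth. -/
noncomputable def Ker.depth (u : ℕ → ℝ) : ℕ∞ := ⨅ (t : ℕ) (_ : P.IsGoodDepth τ u t), (t : ℕ∞)

/-- The number of positions in the block that ends at the smallest good depth. The value is
meaningless if there is no good depth. -/
noncomputable def Ker.blockLen (u : ℕ → ℝ) : ℕ := (P.depth τ u).toNat + 1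

/-- In each of the positions `0, …, t`, the symbol is known or the uniform variable is below the
level `α_k` for all the possible contexts. -/
def Ker.BelowLevel (k t : ℕ) (u : ℕ → ℝ) : Prop :=
  ∀ j ≤ t, (∃ a, P.symbolY (u j) = some a) ∨
    u j < P.alphaLen τ k (P.ctxLen τ (shift (j + 1) u))

/-- The demand of the first block: the smallest `k` such that its uniform variables are below the
level `α_k` in the positions where the symbol is unknown. The symbols of the block are then determined
by the block and by the `k` symbols before it. -/
noncomputable def Ker.demand (u : ℕ → ℝ) : ℕ∞ :=
  ⨅ (k : ℕ) (_ : P.BelowLevel τ k (P.depth τ u).toNat u), (k : ℕ∞)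

/-- The sequence that remains when the first block is removed. -/
noncomputable def Ker.next (u : ℕ → ℝ) : ℕ → ℝ := shift (P.blockLen τ u) u

variable {P τ}

lemma Ker.maxCtxLength_eq (U : ℤ → ℝ) (n : ℤ) :
    P.maxCtxLength τ U n = P.ctxLen τ (backward U n) := by
  refine le_antisymm (iSup_le fun a => ?_) (iSup_le fun x => ?_)
  · exact le_iSup (fun x => (τ.context (P.fill (backward U n) x)).length) fun r => a (n - r)
  · refine le_trans (le_of_eq ?_) (le_iSup _ fun j : ℤ => x (n - j).toNat)
    congr 2
    funext r
    simp [fill, filledPast, backward]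

lemma Ker.isGoodTime_iff (U : ℤ → ℝ) (t : ℕ) :
    P.IsGoodTime τ U 0 (-t) ↔ P.IsGoodDepth τ (backward U 0) t := by
  have key : ∀ j : ℕ, ((∃ a, P.symbolY (U (-j)) = some a) ∨
      P.maxCtxLength τ U (-j - 1) ≤ (((-j : ℤ) - -t).toNat : ℕ∞)) ↔
      ((∃ a, P.symbolY (backward U 0 j) = some a) ∨
        P.ctxLen τ (shift (j + 1) (backward U 0)) ≤ ((t - j : ℕ) : ℕ∞)) := by
    intro j
    have h1 : ((-j : ℤ) - -t).toNat = t - j := by omega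
    have h2 : (0 : ℤ) - (j + 1 : ℕ) = -j - 1 := by push_cast; ring
    rw [maxCtxLength_eq, shift_backward, h1, h2, backward, zero_sub]
  constructor
  · rintro ⟨-, h⟩ j hj
    exact (key j).1 (h (-j) ⟨by omega, by omega⟩)
  · intro h
    refine ⟨by omega, fun j hj => ?_⟩
    obtain ⟨i, rfl⟩ : ∃ i : ℕ, j = -i := ⟨(-j).toNat, by have := hj.2; omega⟩
    exact (key i).2 (h i (by have := hj.1; omega))

lemma Ker.absThetaBar_eq (U : ℤ → ℝ) : P.absThetaBar τ U = P.depth τ (backward U 0) := by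
  simp only [absThetaBar, depth, isGoodTime_iff]

lemma iInf_nat_le_iff {p : ℕ → Prop} {k : ℕ} :
    (⨅ (t : ℕ) (_ : p t), (t : ℕ∞)) ≤ k ↔ ∃ t ≤ k, p t := by
  constructor
  · intro h
    by_contra! hn
    have : ((k + 1 : ℕ) : ℕ∞) ≤ ⨅ (t : ℕ) (_ : p t), (t : ℕ∞) :=
      le_iInf₂ fun t ht => by
        have : k < t := by by_contra hk; exact hn t (not_lt.1 hk) ht
        exact_mod_cast this
    have := this.trans h
    norm_cast at this
    omega
  · rintro ⟨t, htk, ht⟩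
    exact (iInf₂_le t ht).trans (by exact_mod_cast htk)

lemma iInf_nat_eq_coe {p : ℕ → Prop} (h : (⨅ (t : ℕ) (_ : p t), (t : ℕ∞)) < ⊤) :
    p (⨅ (t : ℕ) (_ : p t), (t : ℕ∞)).toNat := by
  obtain ⟨k, hk⟩ := ENat.ne_top_iff_exists.1 h.ne
  rw [← hk, ENat.toNat_natCast]
  obtain ⟨t, htk, ht⟩ := iInf_nat_le_iff.1 hk.symm.le
  have h2 := iInf_nat_le_iff.2 ⟨t, le_rfl, ht⟩
  rw [← hk] at h2
  norm_cast at h2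
  rwa [le_antisymm h2 htk]

lemma Ker.isGoodDepth_depth {u : ℕ → ℝ} (h : P.depth τ u < ⊤) :
    P.IsGoodDepth τ u (P.depth τ u).toNat := iInf_nat_eq_coe h

/-- If the contexts are decided by the `l` most recent positions of `u`, a past compatible with `u`
in these positions has a finite context. -/
lemma Ker.exists_context_of_ctxLen_le {u : ℕ → ℝ} {l : ℕ} (h : P.ctxLen τ u ≤ l) {x : Past A}
    (hx : ∀ r < l, ∀ a, P.symbolY (u r) = some a → x r = a) :
    ∃ v, τ.context x = .fin v ∧ (v.length : ℕ∞) ≤ P.ctxLen τ u ∧ v.length ≤ l := by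
  have h1 : (τ.context (P.fill u x)).length ≤ P.ctxLen τ u :=
    le_iSup (fun x => (τ.context (P.fill u x)).length) x
  cases hc : τ.context (P.fill u x) with
  | inf y =>
    rw [hc] at h1
    exact absurd (h1.trans h) (by simp [Str.length])
  | fin v =>
    rw [hc] at h1
    have h2 : v.length ≤ l := ENat.natCast_le_natCast.1 (h1.trans h)
    refine ⟨v, ContextTree.context_congr hc fun i hi => ?_, h1, h2⟩
    rw [fill]
    cases hy : P.symbolY (u i) with
    | none => rfl
    | some a => exact (hx i (by omega) a hy).symm

/-- The maximum context length is decided by the positions that it involves. -/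
lemma Ker.ctxLen_congr {u u' : ℕ → ℝ} {l : ℕ} (h : P.ctxLen τ u ≤ l)
    (huu : ∀ r < l, P.symbolY (u r) = P.symbolY (u' r)) : P.ctxLen τ u' = P.ctxLen τ u := by
  refine iSup_congr fun x => ?_
  have h1 : ∀ r < l, P.fill u x r = P.fill u' x r := fun r hr => by rw [fill, fill, huu r hr]
  obtain ⟨v, hv, -, hvl⟩ := exists_context_of_ctxLen_le h (x := P.fill u x)
    (fun r hr a ha => by simp [fill, ha])
  rw [hv, ContextTree.context_congr hv fun i hi => h1 i (by omega)]

omit [Encodable A] in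
lemma Ker.alphaLen_le {v : List A} {i : ℕ∞} (hv : Str.fin v ∈ τ.contexts) (hi : v.length ≤ i)
    (k : ℕ) : P.alphaLen τ k i ≤ P.alphaCtx k v := by
  refine csInf_le ⟨0, ?_⟩ ⟨v, ⟨hv, hi⟩, rfl⟩
  rintro _ ⟨v, -, rfl⟩
  exact Real.iInf_nonneg fun _ => tsum_nonneg fun _ => Real.iInf_nonneg fun _ => P.nonneg _ _

/-! ### Coalescence of the trajectories -/

omit [Encodable A] in
/-- The past at position `0` included, when the positions `n - 1, …, 0` of `u` are processed by `F`
in this order, starting from the past `x`. -/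
def run (F : Past A → ℝ → A) (x : Past A) : ℕ → (ℕ → ℝ) → Past A
  | 0, _ => x
  | n + 1, u => consPast (F (run F x n (shift 1 u)) (u 0)) (run F x n (shift 1 u))

omit [Encodable A] in
lemma run_add (F : Past A → ℝ → A) (x : Past A) (m n : ℕ) (u : ℕ → ℝ) :
    run F x (m + n) u = run F (run F x n (shift m u)) m u := by
  induction m generalizing u with
  | zero => simp [run, shift_zero]
  | succ m ih =>
    rw [Nat.add_right_comm, run, run, ih, shift_shift, Nat.add_comm 1]

omit [Encodable A] in
lemma pastAfter_eq_run (F : Past A → ℝ → A) (x : Past A) (U : ℤ → ℝ) (k : ℤ) (n : ℕ) :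
    pastAfter F x U k n = run F x n (backward U (k + n - 1)) := by
  induction n with
  | zero => rfl
  | succ n ih =>
    rw [pastAfter, run, ih, shift_backward]
    have h1 : k + (n + 1 : ℕ) - 1 = k + n := by push_cast; ring
    have h2 : k + (n + 1 : ℕ) - 1 - (1 : ℕ) = k + n - 1 := by push_cast; ring
    rw [h2, h1]
    simp [backward]

omit [Encodable A] in
lemma iterF_eq_run (F : Past A → ℝ → A) (x : Past A) (U : ℤ → ℝ) (i : ℤ) (n : ℕ) :
    iterF F x U (i - n) i = run F x (n + 1) (backward U i) 0 := by
  rw [iterF, pastAfter_eq_run, run, shift_backward]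
  have h1 : (i - (i - n)).toNat = n := by omega
  have h2 : i - n + n - 1 = i - (1 : ℕ) := by push_cast; ring
  rw [h1, h2]
  simp [backward, consPast]

omit [Encodable A] in
/-- Coalescence is preserved when the trajectories start earlier. -/
lemma iterF_congr_of_le {F : Past A → ℝ → A} {U : ℤ → ℝ} {i : ℤ} {n n' : ℕ} (hn : n ≤ n')
    (h : ∀ x y, iterF F x U (i - n) i = iterF F y U (i - n) i) (x y : Past A) :
    iterF F x U (i - n') i = iterF F y U (i - n') i := by
  obtain ⟨k, rfl⟩ := Nat.exists_eq_add_of_le hn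
  simp only [iterF_eq_run] at h ⊢
  rw [Nat.add_right_comm, run_add, run_add F y]
  exact h _ _

variable [Nonempty A]

lemma Ker.run_apply_of_symbolY (hLC : P.LocallyContinuous τ) {u : ℕ → ℝ} {n r : ℕ} (hr : r < n)
    {a : A} (h : P.symbolY (u r) = some a) (x : Past A) : run (P.update τ) x n u r = a := by
  induction n generalizing u r with
  | zero => omega
  | succ n ih =>
    cases r with
    | zero => exact P.update_of_symbolY hLC h _
    | succ r => exact ih (u := shift 1 u) (by omega) (by rwa [shift, Nat.add_comm])

/-- If, in the positions `0, …, m - 1`, the symbol is known, or the context is decided by these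
positions and the uniform variable is below the level `α_k` of the context, then two trajectories
that agree in the `r ≥ k` older positions also agree in the positions `0, …, m - 1`. -/
lemma Ker.run_congr (hLC : P.LocallyContinuous τ) {k r p m : ℕ} (hkr : k ≤ r) {u : ℕ → ℝ}
    (hu : ∀ j < m, (∃ a, P.symbolY (u j) = some a) ∨
      (P.ctxLen τ (shift (j + 1) u) ≤ ((m - 1 - j : ℕ) : ℕ∞) ∧
        u j < P.alphaLen τ k (P.ctxLen τ (shift (j + 1) u))))
    {x y : Past A}
    (hxy : ∀ i < r, run (P.update τ) x p (shift m u) i = run (P.update τ) y p (shift m u) i) :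
    ∀ i < m + r, run (P.update τ) x (m + p) u i = run (P.update τ) y (m + p) u i := by
  induction m generalizing u with
  | zero => simpa [shift_zero] using hxy
  | succ m ih =>
    have h1 := ih (u := shift 1 u) (fun j hj => by
      have := hu (j + 1) (by omega)
      rw [shift_shift, shift, Nat.add_comm 1 j, Nat.add_comm 1 (j + 1)]
      rwa [show m + 1 - 1 - (j + 1) = m - 1 - j by omega] at this)
      (by rwa [shift_shift, Nat.add_comm 1 m])
    rw [Nat.add_right_comm m 1 p]
    intro i hi
    cases i with
    | succ i => exact h1 i (by omega)
    | zero =>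
      show P.update τ _ _ = P.update τ _ _
      rcases hu 0 (by omega) with ⟨a, ha⟩ | ⟨hc, hl⟩
      · rw [P.update_of_symbolY hLC ha, P.update_of_symbolY hLC ha]
      · rw [zero_add] at hc hl
        obtain ⟨v, hv, hvc, hvm⟩ := P.exists_context_of_ctxLen_le hc
          (x := run (P.update τ) x (m + p) (shift 1 u))
          (fun r hr a ha => P.run_apply_of_symbolY hLC (by omega) ha x)
        exact P.update_congr hLC hv (fun i hi => h1 i (by omega))
          (hl.trans_le (P.alphaLen_le (hv ▸ τ.context_mem _) hvc k))

omit [Nonempty A] in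
variable (P τ) in
/-- The number of positions in the first `n` blocks. -/
noncomputable def Ker.totalLen (n : ℕ) (u : ℕ → ℝ) : ℕ :=
  ∑ b ∈ Finset.range n, P.blockLen τ ((P.next τ)^[b] u)

omit [Nonempty A] in
lemma Ker.totalLen_succ (n : ℕ) (u : ℕ → ℝ) :
    P.totalLen τ (n + 1) u = P.blockLen τ u + P.totalLen τ n (P.next τ u) := by
  rw [totalLen, Finset.sum_range_succ']
  simp [totalLen, add_comm]

omit [Nonempty A] in
lemma Ker.le_totalLen (n : ℕ) (u : ℕ → ℝ) : n ≤ P.totalLen τ n u := by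
  have := Finset.card_nsmul_le_sum (Finset.range n)
    (fun b => P.blockLen τ ((P.next τ)^[b] u)) 1 (fun b _ => by simp [blockLen])
  simpa [totalLen] using this

/-- If, among the first `n` blocks, no block demands more symbols than there are older blocks
among them, then the symbols of these blocks do not depend on the remote past. -/
lemma Ker.run_totalLen_congr (hLC : P.LocallyContinuous τ) {n : ℕ} {u : ℕ → ℝ}
    (hd : ∀ b < n, P.depth τ ((P.next τ)^[b] u) < ⊤)
    (h : ∀ b < n, P.demand τ ((P.next τ)^[b] u) ≤ ((n - 1 - b : ℕ) : ℕ∞)) (x y : Past A) :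
    ∀ i < P.totalLen τ n u,
      run (P.update τ) x (P.totalLen τ n u) u i = run (P.update τ) y (P.totalLen τ n u) u i := by
  induction n generalizing u with
  | zero => simp [totalLen]
  | succ n ih =>
    have h1 := ih (u := P.next τ u) (fun b hb => hd (b + 1) (by omega)) (fun b hb => by
      have := h (b + 1) (by omega)
      rwa [show n + 1 - 1 - (b + 1) = n - 1 - b by omega] at this)
    obtain ⟨k, hkn, hk⟩ := iInf_nat_le_iff.1 (h 0 (by omega))
    have hg := P.isGoodDepth_depth (hd 0 (by omega))
    rw [totalLen_succ]
    refine P.run_congr hLC (k := k) ((by omega : k ≤ n).trans (P.le_totalLen n _)) ?_ h1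
    intro j hj
    rw [blockLen] at hj ⊢
    rcases hg j (by simp; omega) with ha | hc
    · exact Or.inl ha
    · rcases hk j (by simp; omega) with ha | hl
      · exact Or.inl ha
      · exact Or.inr ⟨by simpa using hc, by simpa using hl⟩

end Blocks

/-! ### A renewal equation and its consequences -/

section RenewalEquation

variable {r u : ℕ → ℝ}

/-- The renewal equation `r (n+1) = ∑_{m ≤ n} (u m - u (m+1)) r (n-m)` in summed form. -/
lemma sum_mul_eq_one_of_renewal (hr0 : r 0 = 1) (hu0 : u 0 = 1)
    (hrec : ∀ n, r (n + 1) = ∑ m ∈ Finset.range (n + 1), (u m - u (m + 1)) * r (n - m)) (n : ℕ) :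
    ∑ m ∈ Finset.range (n + 1), u m * r (n - m) = 1 := by
  induction n with
  | zero => simp [hr0, hu0]
  | succ n ih =>
    rw [Finset.sum_range_succ', hu0, one_mul, Nat.sub_zero, hrec, ← Finset.sum_add_distrib, ← ih]
    refine Finset.sum_congr rfl fun m _ => ?_
    rw [Nat.add_sub_add_right]
    ring

lemma tendsto_zero_of_renewal (hr : ∀ n, 0 ≤ r n) (hra : Antitone r) (hu : ∀ n, 0 ≤ u n)
    (hsum : ∀ n, ∑ m ∈ Finset.range (n + 1), u m * r (n - m) = 1)
    (hdiv : Tendsto (fun n => ∑ m ∈ Finset.range n, u m) atTop atTop) :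
    Tendsto r atTop (𝓝 0) := by
  have h1 : ∀ n, r n * ∑ m ∈ Finset.range (n + 1), u m ≤ 1 := fun n => by
    rw [← hsum n, Finset.mul_sum]
    refine Finset.sum_le_sum fun m _ => ?_
    rw [mul_comm]
    exact mul_le_mul_of_nonneg_left (hra (Nat.sub_le n m)) (hu m)
  have h2 : Tendsto (fun n => ∑ m ∈ Finset.range (n + 1), u m) atTop atTop :=
    hdiv.comp (tendsto_add_atTop_nat 1)
  refine squeeze_zero' (Eventually.of_forall hr) ?_ h2.inv_tendsto_atTop
  filter_upwards [h2.eventually_gt_atTop 0] with n hn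
  rw [Pi.inv_apply, ← one_div, le_div_iff₀ hn]
  exact h1 n

lemma summable_of_renewal (hr : ∀ n, 0 ≤ r n) {β : ℝ} (hβ : 0 < β) (hu : ∀ n, β ≤ u n)
    (hsum : ∀ n, ∑ m ∈ Finset.range (n + 1), u m * r (n - m) = 1) : Summable r := by
  refine summable_of_sum_range_le (c := 1 / β) hr fun n => ?_
  rw [le_div_iff₀ hβ]
  calc (∑ i ∈ Finset.range n, r i) * β
      ≤ (∑ i ∈ Finset.range (n + 1), r i) * β := by
        rw [Finset.sum_range_succ]
        have := hr n
        gcongr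
        linarith
    _ = ∑ m ∈ Finset.range (n + 1), β * r (n - m) := by
        rw [← Finset.mul_sum, ← Finset.sum_range_reflect, mul_comm]
        simp
    _ ≤ ∑ m ∈ Finset.range (n + 1), u m * r (n - m) :=
        Finset.sum_le_sum fun m _ => mul_le_mul_of_nonneg_right (hu m) (hr _)
    _ = 1 := hsum n

/-- If the renewal equation is defective (its coefficients have sum at most `1 - β < 1`) and its
coefficients decay geometrically, then its solution decays geometrically. -/
lemma geometric_of_renewal (hr0 : r 0 = 1)
    (hrec : ∀ n, r (n + 1) = ∑ m ∈ Finset.range (n + 1), (u m - u (m + 1)) * r (n - m))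
    (hu0 : u 0 = 1) (hua : ∀ n, 0 ≤ u n - u (n + 1)) {β : ℝ} (hβ : 0 < β) (hu : ∀ n, β ≤ u n)
    {D d : ℝ} (hd0 : 0 < d) (hd1 : d < 1) (hD : ∀ n, u n - u (n + 1) ≤ D * d ^ n) :
    ∃ ρ : ℝ, 0 < ρ ∧ ρ < 1 ∧ ∀ n, r n ≤ ρ ^ n := by
  set c : ℕ → ℝ := fun m => u m - u (m + 1) with hc
  obtain ⟨S, hS1, hS⟩ : ∃ S : ℝ, 1 < S ∧ d * S < 1 := by
    obtain ⟨S, h1, h2⟩ := exists_between ((one_lt_inv₀ hd0).2 hd1)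
    exact ⟨S, h1, by rwa [mul_comm, ← lt_inv_mul_iff₀' hd0, mul_one]⟩
  have hbd : Summable fun m => c m * S ^ (m + 1) := by
    refine Summable.of_nonneg_of_le (fun m => mul_nonneg (hua m) (by positivity)) (fun m => ?_)
      ((summable_geometric_of_lt_one (by positivity) hS).mul_left (D * S))
    calc c m * S ^ (m + 1) ≤ D * d ^ m * S ^ (m + 1) := by gcongr; exact hD m
      _ = D * S * (d * S) ^ m := by rw [mul_pow, pow_succ]; ring
  have hlim : Tendsto (fun s : ℝ => ∑' m, c m * s ^ (m + 1)) (𝓝[>] 1) (𝓝 (∑' m, c m * 1 ^ (m + 1)))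
      := by
    refine tendsto_tsum_of_dominated_convergence hbd (fun m => ?_) ?_
    · exact Tendsto.mono_left (Continuous.tendsto (by fun_prop) 1) nhdsWithin_le_nhds
    · filter_upwards [Ioo_mem_nhdsGT hS1] with s hs m
      have h0 : 0 ≤ s := by linarith [hs.1]
      rw [Real.norm_of_nonneg (mul_nonneg (hua m) (by positivity))]
      have := hua m
      gcongr
      exact hs.2.le
  have hlt : ∑' m, c m * 1 ^ (m + 1) < 1 := by
    refine lt_of_le_of_lt (Real.tsum_le_of_sum_range_le (c := 1 - β) (fun m => ?_) fun n => ?_)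
      (by linarith)
    · rw [one_pow, mul_one]
      exact hua m
    · simp only [one_pow, mul_one, hc]
      rw [Finset.sum_range_sub', hu0]
      linarith [hu n]
  obtain ⟨s, hs, hs1, hsS⟩ := ((hlim.eventually (gt_mem_nhds hlt)).and
    (Ioo_mem_nhdsGT hS1)).exists
  have hs0 : 0 < s := by linarith
  refine ⟨s⁻¹, inv_pos.2 hs0, inv_lt_one_of_one_lt₀ hs1, fun n => ?_⟩
  induction n using Nat.strong_induction_on with
  | _ n ih =>
    cases n with
    | zero => simp [hr0]
    | succ n =>
      have hsumm : Summable fun m => c m * s ^ (m + 1) :=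
        Summable.of_nonneg_of_le (fun m => mul_nonneg (hua m) (by positivity))
          (fun m => by have := hua m; gcongr) hbd
      calc r (n + 1) = ∑ m ∈ Finset.range (n + 1), c m * r (n - m) := hrec n
        _ ≤ ∑ m ∈ Finset.range (n + 1), c m * s ^ (m + 1) * s⁻¹ ^ (n + 1) := by
          refine Finset.sum_le_sum fun m hm => ?_
          rw [mul_assoc]
          refine mul_le_mul_of_nonneg_left ((ih (n - m) (by omega)).trans_eq ?_) (hua m)
          have hm' : n + 1 = (n - m) + (m + 1) := by
            have := Finset.mem_range.1 hm
            omega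
          rw [hm', pow_add s⁻¹ (n - m), mul_left_comm, ← mul_pow, mul_inv_cancel₀ hs0.ne',
            one_pow, mul_one]
        _ = (∑ m ∈ Finset.range (n + 1), c m * s ^ (m + 1)) * s⁻¹ ^ (n + 1) := by
          rw [Finset.sum_mul]
        _ ≤ 1 * s⁻¹ ^ (n + 1) := by
          refine mul_le_mul_of_nonneg_right ?_ (by positivity)
          exact (hsumm.sum_le_tsum _ fun m _ => mul_nonneg (hua m) (by positivity)).trans hs.le
        _ = s⁻¹ ^ (n + 1) := one_mul _

/-- A product of numbers in `[α, 1]`, `α > 0`, is bounded away from zero if the deficits are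
summable. -/
lemma exists_pos_le_prod {a : ℕ → ℝ} {α : ℝ} (hα : 0 < α) (ha : ∀ n, α ≤ a n) (ha1 : ∀ n, a n ≤ 1)
    (hs : Summable fun n => 1 - a n) : ∃ β > 0, ∀ n, β ≤ ∏ j ∈ Finset.range n, a j := by
  have hpos : ∀ n, 0 < ∏ j ∈ Finset.range n, a j := fun n =>
    Finset.prod_pos fun j _ => hα.trans_le (ha j)
  have hanti : Antitone fun n => ∏ j ∈ Finset.range n, a j := antitone_nat_of_succ_le fun n => by
    rw [Finset.prod_range_succ]
    exact mul_le_of_le_one_right (hpos n).le (ha1 n)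
  obtain ⟨K, hK⟩ := (((tendsto_sum_nat_add fun n => 1 - a n).eventually
    (gt_mem_nhds (show (0 : ℝ) < 1 / 2 by norm_num)))).exists
  refine ⟨(∏ j ∈ Finset.range K, a j) * (1 / 2), by have := hpos K; positivity, fun n => ?_⟩
  refine le_trans ?_ (hanti (Nat.le_add_left n K))
  simp only
  rw [Finset.prod_range_add]
  refine mul_le_mul_of_nonneg_left ?_ (hpos K).le
  have h1 : ∀ n, 1 - ∑ j ∈ Finset.range n, (1 - a (K + j)) ≤ ∏ j ∈ Finset.range n, a (K + j) := by
    intro n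
    induction n with
    | zero => simp
    | succ n ih =>
      rw [Finset.sum_range_succ, Finset.prod_range_succ]
      have h2 : ∏ j ∈ Finset.range n, a (K + j) ≤ 1 :=
        Finset.prod_le_one (fun j _ => (hα.trans_le (ha _)).le) fun j _ => ha1 _
      nlinarith [ha1 (K + n), mul_nonneg (sub_nonneg.2 h2) (sub_nonneg.2 (ha1 (K + n)))]
  refine le_trans ?_ (h1 n)
  have hs' : Summable fun j => 1 - a (j + K) := (summable_nat_add_iff K).2 hs
  have h3 := hs'.sum_le_tsum (Finset.range n) fun j _ => sub_nonneg.2 (ha1 _)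
  simp only [add_comm _ K] at h3 hK
  linarith

end RenewalEquation

/-! ### The first renewal of an independent sequence of demands -/

section Demands

variable {Ω : Type*} {mΩ : MeasurableSpace Ω} (N : ℕ → Ω → ℕ∞)

/-- The event that, for `1 ≤ k ≤ n`, one of the positions `0, …, k - 1` has a demand larger than the
number of the positions after it up to `k - 1`. -/
def noRenewal (n : ℕ) : Set Ω :=
  {ω | ∀ k, 1 ≤ k → k ≤ n → ∃ b < k, ((k - 1 - b : ℕ) : ℕ∞) < N b ω}

/-- The event that the demands of the last `m` of the positions `0, …, n` do not go beyond `n`. -/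
def lastSatisfied (n m : ℕ) : Set Ω :=
  ⋂ b ∈ Finset.Ico (n + 1 - m) (n + 1), {ω | N b ω ≤ ((n - b : ℕ) : ℕ∞)}

lemma noRenewal_antitone : Antitone (noRenewal N) := fun _ _ hmn _ h k h1 h2 =>
  h k h1 (h2.trans hmn)

variable {N}

lemma mem_lastSatisfied {n m : ℕ} {ω : Ω} : ω ∈ lastSatisfied N n m ↔
    ∀ b, n + 1 - m ≤ b → b ≤ n → N b ω ≤ ((n - b : ℕ) : ℕ∞) := by
  simp [lastSatisfied]

lemma noRenewal_succ (n : ℕ) : noRenewal N (n + 1) = ⋃ m ∈ Finset.range (n + 1),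
    noRenewal N (n - m) ∩ (lastSatisfied N n m \ lastSatisfied N n (m + 1)) := by
  ext ω
  simp only [Set.mem_iUnion, Finset.mem_range, exists_prop]
  constructor
  · intro h
    have hex : ∃ i, i ≤ n ∧ (i : ℕ∞) < N (n - i) ω := by
      obtain ⟨b, hb, hlt⟩ := h (n + 1) (by omega) le_rfl
      refine ⟨n - b, by omega, ?_⟩
      rwa [show n - (n - b) = b by omega, show n - b = n + 1 - 1 - b by omega]
    classical
    have hspec := Nat.find_spec hex
    refine ⟨Nat.find hex, by omega, noRenewal_antitone N (by omega) h, ?_, ?_⟩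
    · refine mem_lastSatisfied.2 fun b hb hbn => ?_
      by_contra hlt
      refine Nat.find_min hex (m := n - b) (by omega) ⟨by omega, ?_⟩
      rwa [show n - (n - b) = b by omega, ← not_le]
    · intro hmem
      have := mem_lastSatisfied.1 hmem (n - Nat.find hex) (by omega) (by omega)
      rw [show n - (n - Nat.find hex) = Nat.find hex by omega] at this
      exact absurd hspec.2 (not_lt.2 this)
  · rintro ⟨m, hm, hno, hlast, hnot⟩ k hk1 hk
    rcases le_or_gt k (n - m) with hkm | hkm
    · exact hno k hk1 hkm
    · refine ⟨n - m, hkm, ?_⟩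
      by_contra hle
      refine hnot (mem_lastSatisfied.2 fun b hb hbn => ?_)
      rcases eq_or_lt_of_le hb with h1 | h1
      · have h2 : b = n - m := by omega
        rw [h2]
        refine (not_lt.1 hle).trans ?_
        exact_mod_cast (by omega : k - 1 - (n - m) ≤ n - (n - m))
      · exact mem_lastSatisfied.1 hlast b (by omega) hbn

variable {m : ℕ → MeasurableSpace Ω}

lemma measurableSet_noRenewal {n : ℕ} {S : Set ℕ} (hS : ∀ b < n, b ∈ S)
    (hN : ∀ b, Measurable[m b] (N b)) : MeasurableSet[⨆ b ∈ S, m b] (noRenewal N n) := by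
  have : noRenewal N n = ⋂ k : ℕ, ⋂ (_ : 1 ≤ k), ⋂ (_ : k ≤ n), ⋃ b : ℕ, ⋃ (_ : b < k),
      N b ⁻¹' Set.Ioi ((k - 1 - b : ℕ) : ℕ∞) := by
    ext ω
    simp [noRenewal]
  rw [this]
  refine MeasurableSet.iInter fun k => MeasurableSet.iInter fun _ => MeasurableSet.iInter fun hk =>
    MeasurableSet.iUnion fun b => MeasurableSet.iUnion fun hb => ?_
  exact le_iSup₂_of_le (f := fun b (_ : b ∈ S) => m b) b (hS b (by omega)) le_rfl _
    (hN b (MeasurableSet.of_discrete))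

lemma measurableSet_lastSatisfied {n k : ℕ} {S : Set ℕ} (hS : ∀ b, n + 1 - k ≤ b → b ∈ S)
    (hN : ∀ b, Measurable[m b] (N b)) : MeasurableSet[⨆ b ∈ S, m b] (lastSatisfied N n k) := by
  refine MeasurableSet.biInter (Finset.countable_toSet _) fun b hb => ?_
  exact le_iSup₂_of_le (f := fun b (_ : b ∈ S) => m b) b (hS b (Finset.mem_Ico.1 hb).1) le_rfl _
    (hN b (MeasurableSet.of_discrete (s := Set.Iic _)))

variable {ν : Measure Ω} (hm : ∀ b, m b ≤ mΩ) (hind : iIndep m ν)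
  (hN : ∀ b, Measurable[m b] (N b)) {p : ℕ → ℝ} (hp : ∀ b (j : ℕ), ν.real {ω | N b ω ≤ j} = p j)

include hind hN hp in
lemma measureReal_lastSatisfied {n k : ℕ} (hk : k ≤ n + 1) :
    ν.real (lastSatisfied N n k) = ∏ j ∈ Finset.range k, p j := by
  have h := (iIndep_iff _ _).1 hind (Finset.Ico (n + 1 - k) (n + 1))
    (f := fun b => {ω | N b ω ≤ ((n - b : ℕ) : ℕ∞)})
    (fun b _ => hN b (MeasurableSet.of_discrete (s := Set.Iic _)))
  rw [measureReal_def, lastSatisfied, h, ENNReal.toReal_prod]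
  simp only [← measureReal_def, hp]
  rw [Finset.prod_Ico_reflect p _ le_rfl, Finset.range_eq_Ico]
  congr 2 <;> omega

include hm hind hN hp in
lemma measureReal_noRenewal_succ [IsProbabilityMeasure ν] (n : ℕ) :
    ν.real (noRenewal N (n + 1)) = ∑ k ∈ Finset.range (n + 1),
      (∏ j ∈ Finset.range k, p j - ∏ j ∈ Finset.range (k + 1), p j) *
        ν.real (noRenewal N (n - k)) := by
  have hle : ∀ S : Set ℕ, (⨆ b ∈ S, m b) ≤ mΩ := fun S => iSup₂_le fun b _ => hm b
  have hm1 : ∀ k, MeasurableSet (noRenewal N k) := fun k =>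
    hle Set.univ _ (measurableSet_noRenewal (fun _ _ => trivial) hN)
  have hm2 : ∀ k, MeasurableSet (lastSatisfied N n k) := fun k =>
    hle Set.univ _ (measurableSet_lastSatisfied (fun _ _ => trivial) hN)
  have hanti : Antitone (lastSatisfied N n) := fun i j hij ω h =>
    mem_lastSatisfied.2 fun b hb => mem_lastSatisfied.1 h b (by omega)
  rw [noRenewal_succ, measureReal_biUnion_finset]
  · refine Finset.sum_congr rfl fun k hk => ?_
    have hk' : k ≤ n := Nat.lt_succ_iff.1 (Finset.mem_range.1 hk)
    have hdisj : Disjoint {b | b < n - k} {b | n - k ≤ b} :=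
      Set.disjoint_left.2 fun b (h1 : b < n - k) (h2 : n - k ≤ b) => by omega
    have h1 := (Indep_iff _ _ _).1 (indep_iSup_of_disjoint hm hind hdisj) _ _
      (measurableSet_noRenewal (fun _ hb => hb) hN)
      ((measurableSet_lastSatisfied (n := n) (k := k)
        (fun b (hb : n + 1 - k ≤ b) => show n - k ≤ b by omega) hN).diff
        (measurableSet_lastSatisfied (n := n) (k := k + 1)
        (fun b (hb : n + 1 - (k + 1) ≤ b) => show n - k ≤ b by omega) hN))
    rw [measureReal_def, h1, ENNReal.toReal_mul, ← measureReal_def, ← measureReal_def,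
      measureReal_sdiff (hanti k.le_succ) (hm2 _),
      measureReal_lastSatisfied hind hN hp (by omega),
      measureReal_lastSatisfied hind hN hp (by omega), mul_comm]
  · intro i _ j _ hij
    refine Set.disjoint_left.2 fun ω hi hj => ?_
    rcases lt_or_gt_of_ne hij with h | h
    · exact hi.2.2 (hanti (Nat.succ_le_of_lt h) hj.2.1)
    · exact hj.2.2 (hanti (Nat.succ_le_of_lt h) hi.2.1)
  · exact fun k _ => (hm1 _).inter ((hm2 _).diff (hm2 _))

end Demands

/-! ### Sequences of independent uniform variables -/

section Uniform

/-- The uniform law on `[0, 1[`. -/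
noncomputable def unif : Measure ℝ := volume.restrict (Set.Ico (0 : ℝ) 1)

instance : IsProbabilityMeasure unif := ⟨by simp [unif]⟩

/-- The law of a sequence of independent variables, uniform on `[0, 1[`. -/
noncomputable def unifSeq : Measure (ℕ → ℝ) := Measure.infinitePi fun _ => unif

instance : IsProbabilityMeasure unifSeq := by unfold unifSeq; infer_instance

lemma measurable_backward {Ω : Type*} [MeasurableSpace Ω] {U : ℤ → Ω → ℝ}
    (hU : ∀ i, Measurable (U i)) (n : ℤ) : Measurable fun ω => backward (fun i => U i ω) n :=
  measurable_pi_iff.2 fun r => hU (n - r)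

lemma IsIIDUniform.map_backward {Ω : Type*} [MeasurableSpace Ω] {μ : Measure Ω} {U : ℤ → Ω → ℝ}
    (hU : IsIIDUniform μ U) (n : ℤ) :
    μ.map (fun ω => backward (fun i => U i ω) n) = unifSeq := by
  have hinj : Function.Injective fun r : ℕ => n - (r : ℤ) := fun a b h => by
    simp only at h
    omega
  have h := (hU.indep.precomp hinj).map_fun_eq_infinitePi_map fun r : ℕ =>
    hU.measurable (n - r)
  simp only [hU.law] at h
  exact h

lemma measurable_shift (n : ℕ) : Measurable (shift (β := ℝ) n) :=
  measurable_pi_iff.2 fun k => measurable_pi_apply (n + k)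

lemma measurePreserving_shift (n : ℕ) : MeasurePreserving (shift n) unifSeq unifSeq :=
  ⟨measurable_shift n, Measure.map_infinitePi_infinitePi_of_inj (P := fun _ : ℕ => unif)
    (f := fun k : ℕ => n + k) fun a b h => by simpa using h⟩

lemma measurePreserving_eval (n : ℕ) :
    MeasurePreserving (fun u : ℕ → ℝ => u n) unifSeq unif :=
  measurePreserving_eval_infinitePi (fun _ => unif) n

/-- The first `n` terms of a sequence and the rest of it are independent. -/
lemma lintegral_mul_comp_shift {n : ℕ} {f g : (ℕ → ℝ) → ℝ≥0∞} (hf : Measurable f)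
    (hg : Measurable g) (hfn : ∀ u u', (∀ i < n, u i = u' i) → f u = f u') :
    ∫⁻ u, f u * g (shift n u) ∂unifSeq = (∫⁻ u, f u ∂unifSeq) * ∫⁻ u, g u ∂unifSeq := by
  let m : ℕ → MeasurableSpace (ℕ → ℝ) := fun i =>
    MeasurableSpace.comap (fun u => u i) inferInstance
  have hm : ∀ i, m i ≤ MeasurableSpace.pi := fun i => (measurable_pi_apply i).comap_le
  have hind : iIndep m unifSeq :=
    (iIndepFun_infinitePi (P := fun _ : ℕ => unif) (X := fun _ (t : ℝ) => t)
      fun _ => measurable_id).iIndep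
  have hdisj : Disjoint {i | i < n} {i | n ≤ i} :=
    Set.disjoint_left.2 fun i (h1 : i < n) (h2 : n ≤ i) => by omega
  have hmem : ∀ (S : Set ℕ) (i : ℕ), i ∈ S →
      Measurable[⨆ i ∈ S, m i] fun u : ℕ → ℝ => u i := fun S i hi =>
    (comap_measurable _).mono (le_iSup₂_of_le (f := fun i (_ : i ∈ S) => m i) i hi le_rfl) le_rfl
  have hf' : Measurable[⨆ i ∈ {i | i < n}, m i] f := by
    -- `f` does not see the terms that are replaced by zero
    have htr : Measurable[⨆ i ∈ {i | i < n}, m i] fun (u : ℕ → ℝ) (i : ℕ) =>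
        if i < n then u i else 0 := by
      refine @measurable_pi_iff _ _ _ (_) _ _ |>.2 fun i => ?_
      by_cases hi : i < n
      · simpa only [hi, if_true] using hmem {i | i < n} i hi
      · simpa only [hi, if_false] using @measurable_const _ _ _ (_) _
    have heq : f = f ∘ fun (u : ℕ → ℝ) (i : ℕ) => if i < n then u i else 0 := by
      funext u
      exact hfn _ _ fun i hi => by simp [hi]
    rw [heq]
    exact hf.comp htr
  have hg' : Measurable[⨆ i ∈ {i | n ≤ i}, m i] fun u => g (shift n u) := by
    refine hg.comp (@measurable_pi_iff _ _ _ (_) _ _ |>.2 fun i => ?_)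
    exact hmem {i | n ≤ i} (n + i) (Nat.le_add_right n i)
  have h := lintegral_mul_eq_lintegral_mul_lintegral_of_independent_measurableSpace
    (iSup₂_le fun i _ => hm i) (iSup₂_le fun i _ => hm i)
    (indep_iSup_of_disjoint hm hind hdisj) hf' hg'
  rw [h, (measurePreserving_shift n).lintegral_comp hg]

end Uniform

/-! ### Measurability of the block variables -/

section Measurability

lemma measurable_of_forall_le_natCast {Ω : Type*} [MeasurableSpace Ω] {f : Ω → ℕ∞}
    (h : ∀ k : ℕ, MeasurableSet {ω | f ω ≤ k}) : Measurable f := by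
  have hfin : ∀ k : ℕ, MeasurableSet {ω | f ω < k} := fun k => by
    have : {ω | f ω < k} = ⋃ j : ℕ, ⋃ (_ : j < k), {ω | f ω ≤ j} := by
      ext ω
      simp only [Set.mem_ofPred_eq, Set.mem_iUnion, exists_prop]
      constructor
      · intro hlt
        obtain ⟨j, hj⟩ := ENat.ne_top_iff_exists.1 hlt.ne_top
        rw [← hj] at hlt ⊢
        exact ⟨j, by exact_mod_cast hlt, le_rfl⟩
      · rintro ⟨j, hj, hle⟩
        exact hle.trans_lt (by exact_mod_cast hj)
    rw [this]
    exact MeasurableSet.iUnion fun j => MeasurableSet.iUnion fun _ => h j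
  refine measurable_to_countable' fun x => ?_
  induction x using ENat.recTopCoe with
  | top =>
    have : f ⁻¹' {⊤} = (⋃ k : ℕ, {ω | f ω ≤ k})ᶜ := by
      ext ω
      simp only [Set.mem_preimage, Set.mem_singleton_iff, Set.mem_compl_iff, Set.mem_iUnion,
        Set.mem_ofPred_eq]
      constructor
      · rintro h ⟨k, hk⟩
        simp [h] at hk
      · intro h
        by_contra hne
        obtain ⟨k, hk⟩ := ENat.ne_top_iff_exists.1 hne
        exact h ⟨k, hk.symm.le⟩
    rw [this]
    exact (MeasurableSet.iUnion h).compl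
  | coe k =>
    have : f ⁻¹' {(k : ℕ∞)} = {ω | f ω ≤ k} \ {ω | f ω < k} := by
      ext ω
      simp [le_antisymm_iff]
    rw [this]
    exact (h k).diff (hfin k)

variable {A : Type*} [Encodable A] {P : Ker A} {τ : ContextTree A}

omit [Encodable A] in
lemma Ker.summable_alpha [Nonempty A] : Summable P.alpha :=
  Summable.of_nonneg_of_le P.alpha_nonneg (fun a => P.alpha_le a fun _ => Classical.arbitrary A)
    (P.hasSum_one _).summable

omit [Encodable A] in
lemma Ker.alphaMinusOne_le_one [Nonempty A] : P.alphaMinusOne ≤ 1 := by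
  rw [← (P.hasSum_one fun _ => Classical.arbitrary A).tsum_eq]
  exact P.summable_alpha.tsum_le_tsum (fun a => P.alpha_le a _) (P.hasSum_one _).summable

lemma Ker.symbolY_eq_some_iff [Nonempty A] {t : ℝ} {a : A} : P.symbolY t = some a ↔
    t ∈ cell (Encodable.encode (α := A)) P.alpha a := by
  refine ⟨mem_cell_of_symbolY, fun h => ?_⟩
  have hex : ∃ a : A, P.leftEnd a ≤ t ∧ t < P.leftEnd a + P.alpha a := ⟨a, h⟩
  rw [symbolY, dif_pos hex]
  exact congrArg some (eq_of_mem_cell Encodable.encode_injective P.alpha_nonneg P.summable_alpha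
    hex.choose_spec h)

lemma Ker.measurable_symbolY [Nonempty A] : Measurable[_, ⊤] P.symbolY := by
  have hsome : ∀ a, MeasurableSet (P.symbolY ⁻¹' {some a}) := fun a => by
    have : P.symbolY ⁻¹' {some a} = cell (Encodable.encode (α := A)) P.alpha a := by
      ext t
      exact symbolY_eq_some_iff
    rw [this]
    exact measurableSet_cell _ _ _
  refine @measurable_to_countable' _ _ ⊤ _ _ _ fun y => ?_
  cases y with
  | some a => exact hsome a
  | none =>
    have : P.symbolY ⁻¹' {none} = (⋃ a, P.symbolY ⁻¹' {some a})ᶜ := by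
      ext t
      simp [← Option.eq_none_iff_forall_ne_some]
    rw [this]
    exact (MeasurableSet.iUnion hsome).compl

lemma Ker.measurableSet_symbolY [Nonempty A] (j : ℕ) :
    MeasurableSet {u : ℕ → ℝ | ∃ a, P.symbolY (u j) = some a} := by
  let _ : MeasurableSpace (Option A) := ⊤
  have h : Measurable fun u : ℕ → ℝ => P.symbolY (u j) :=
    P.measurable_symbolY.comp (measurable_pi_apply j)
  exact @h {y | ∃ a, y = some a} trivial

lemma Ker.measurable_ctxLen [Nonempty A] : Measurable (P.ctxLen τ) := by
  refine measurable_of_forall_le_natCast fun l => ?_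
  let _ : MeasurableSpace (Option A) := ⊤
  let π : (ℕ → ℝ) → (Fin l → Option A) := fun u i => P.symbolY (u i)
  have hπ : Measurable π := measurable_pi_iff.2 fun i =>
    P.measurable_symbolY.comp (measurable_pi_apply (i : ℕ))
  -- the event is a preimage under `π`, whose values form a countable set
  have : {u | P.ctxLen τ u ≤ l} = π ⁻¹' (π '' {u | P.ctxLen τ u ≤ l}) := by
    refine Set.Subset.antisymm (Set.subset_preimage_image _ _) ?_
    rintro u ⟨u', hu', heq⟩
    have h1 := P.ctxLen_congr (u' := u) hu' fun r hr => congrFun heq ⟨r, hr⟩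
    exact h1.le.trans hu'
  rw [this]
  exact hπ (Set.to_countable _).measurableSet

lemma Ker.measurableSet_isGoodDepth [Nonempty A] (t : ℕ) :
    MeasurableSet {u | P.IsGoodDepth τ u t} := by
  have : {u | P.IsGoodDepth τ u t} = ⋂ j : ℕ, ⋂ (_ : j ≤ t),
      ({u : ℕ → ℝ | ∃ a, P.symbolY (u j) = some a} ∪
        (P.ctxLen τ ∘ shift (j + 1)) ⁻¹' Set.Iic ((t - j : ℕ) : ℕ∞)) := by
    ext u
    simp [IsGoodDepth]
  rw [this]
  exact MeasurableSet.iInter fun j => MeasurableSet.iInter fun _ =>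
    (P.measurableSet_symbolY j).union
      ((P.measurable_ctxLen.comp (measurable_shift _)) MeasurableSet.of_discrete)

lemma measurable_iInf_nat {Ω : Type*} [MeasurableSpace Ω] {p : ℕ → Ω → Prop}
    (h : ∀ t, MeasurableSet {ω | p t ω}) :
    Measurable fun ω => ⨅ (t : ℕ) (_ : p t ω), (t : ℕ∞) := by
  refine measurable_of_forall_le_natCast fun k => ?_
  have : {ω | (⨅ (t : ℕ) (_ : p t ω), (t : ℕ∞)) ≤ k} = ⋃ t : ℕ, ⋃ (_ : t ≤ k), {ω | p t ω} := by
    ext ω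
    simp only [Set.mem_ofPred_eq, iInf_nat_le_iff, Set.mem_iUnion, exists_prop]
  rw [this]
  exact MeasurableSet.iUnion fun t => MeasurableSet.iUnion fun _ => h t

lemma Ker.measurable_depth [Nonempty A] : Measurable (P.depth τ) :=
  measurable_iInf_nat fun t => P.measurableSet_isGoodDepth t

lemma Ker.measurable_blockLen [Nonempty A] : Measurable (P.blockLen τ) :=
  (Measurable.of_discrete (f := fun x : ℕ∞ => x.toNat + 1)).comp P.measurable_depth

lemma Ker.measurable_alphaLen_ctxLen [Nonempty A] (k n : ℕ) :
    Measurable fun u => P.alphaLen τ k (P.ctxLen τ (shift n u)) :=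
  (Measurable.of_discrete (f := P.alphaLen τ k)).comp
    (P.measurable_ctxLen.comp (measurable_shift n))

lemma Ker.measurableSet_belowLevel [Nonempty A] (k : ℕ) :
    MeasurableSet {u | P.BelowLevel τ k (P.depth τ u).toNat u} := by
  have : {u | P.BelowLevel τ k (P.depth τ u).toNat u} = ⋂ j : ℕ,
      (((fun u => (P.depth τ u).toNat) ⁻¹' Set.Iio j ∪
        {u : ℕ → ℝ | ∃ a, P.symbolY (u j) = some a}) ∪
        {u | u j < P.alphaLen τ k (P.ctxLen τ (shift (j + 1) u))}) := by
    ext u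
    simp only [BelowLevel, Set.mem_ofPred_eq, Set.mem_iInter, Set.mem_union, Set.mem_preimage,
      Set.mem_Iio]
    refine forall_congr' fun j => ?_
    rw [or_assoc, imp_iff_not_or, not_le]
  rw [this]
  exact MeasurableSet.iInter fun j => (((Measurable.of_discrete (f := ENat.toNat)).comp
    P.measurable_depth MeasurableSet.of_discrete).union (P.measurableSet_symbolY j)).union
    (measurableSet_lt (measurable_pi_apply j) (P.measurable_alphaLen_ctxLen k (j + 1)))

lemma Ker.measurable_demand [Nonempty A] : Measurable (P.demand τ) :=
  measurable_iInf_nat fun k => P.measurableSet_belowLevel k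

lemma Ker.measurable_next [Nonempty A] : Measurable (P.next τ) := by
  refine measurable_pi_iff.2 fun k => ?_
  have h : Measurable fun x : ℕ × (ℕ → ℝ) => x.2 (x.1 + k) :=
    measurable_from_prod_countable_right fun n => measurable_pi_apply (n + k)
  exact h.comp (P.measurable_blockLen.prodMk measurable_id)

end Measurability

/-! ### Independence of the successive blocks -/

section IndependentBlocks

variable {A : Type*} [Encodable A] {P : Ker A} {τ : ContextTree A}

lemma Ker.isGoodDepth_congr {u u' : ℕ → ℝ} {t : ℕ} (h : ∀ i ≤ t, u i = u' i)
    (hu : P.IsGoodDepth τ u t) : P.IsGoodDepth τ u' t := by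
  intro j hj
  refine (hu j hj).imp (fun ha => by rwa [← h j hj]) fun hc => ?_
  rwa [P.ctxLen_congr hc fun r hr => ?_]
  rw [shift, shift, h _ (by omega)]

lemma Ker.depth_le_congr {u u' : ℕ → ℝ} {k : ℕ} (h : ∀ i ≤ k, u i = u' i) :
    P.depth τ u ≤ k ↔ P.depth τ u' ≤ k := by
  rw [depth, depth, iInf_nat_le_iff, iInf_nat_le_iff]
  exact exists_congr fun t => and_congr_right fun ht =>
    ⟨isGoodDepth_congr fun i hi => h i (hi.trans ht),
      isGoodDepth_congr fun i hi => (h i (hi.trans ht)).symm⟩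

/-- The smallest good depth is a stopping time of the exploration of the past. -/
lemma Ker.depth_congr {u u' : ℕ → ℝ} {t : ℕ} (h : ∀ i ≤ t, u i = u' i) (hu : P.depth τ u = t) :
    P.depth τ u' = t := by
  have h1 := (depth_le_congr h).1 hu.le
  refine le_antisymm h1 ?_
  obtain ⟨k, hk⟩ := ENat.ne_top_iff_exists.1 (ne_top_of_le_ne_top (ENat.natCast_ne_top t) h1)
  rw [← hk] at h1 ⊢
  have hkt : k ≤ t := by exact_mod_cast h1
  exact hu.symm.le.trans ((depth_le_congr fun i hi => h i (hi.trans hkt)).2 hk.symm.le)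

lemma Ker.demand_congr {u u' : ℕ → ℝ} {t : ℕ} (h : ∀ i ≤ t, u i = u' i) (hu : P.depth τ u = t) :
    P.demand τ u' = P.demand τ u := by
  have hu' := depth_congr h hu
  have hg : P.IsGoodDepth τ u t := by
    have := P.isGoodDepth_depth (τ := τ) (u := u) (by rw [hu]; exact ENat.natCast_lt_top t)
    rwa [hu] at this
  rw [demand, demand, hu, hu', ENat.toNat_natCast]
  have key : ∀ k, P.BelowLevel τ k t u' ↔ P.BelowLevel τ k t u := fun k => by
    refine forall_congr' fun j => forall_congr' fun hj => ?_
    rw [← h j hj]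
    rcases hg j hj with ha | hc
    · simp [ha]
    · rw [P.ctxLen_congr (u' := shift (j + 1) u') hc fun r hr => ?_]
      rw [shift, shift, h _ (by omega)]
  simp only [key]

variable [Nonempty A]

/-- The first block is independent of the sequence that remains when it is removed, and this
sequence has the same law as the original one. -/
lemma Ker.lintegral_mul_comp_next (hfin : ∀ᵐ u ∂unifSeq, P.depth τ u < ⊤) (f : ℕ × ℕ∞ → ℝ≥0∞)
    {g : (ℕ → ℝ) → ℝ≥0∞} (hg : Measurable g) :
    ∫⁻ u, f (P.blockLen τ u, P.demand τ u) * g (P.next τ u) ∂unifSeq =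
      (∫⁻ u, f (P.blockLen τ u, P.demand τ u) ∂unifSeq) * ∫⁻ u, g u ∂unifSeq := by
  classical
  have hX : Measurable fun u => f (P.blockLen τ u, P.demand τ u) :=
    (Measurable.of_discrete (f := f)).comp (P.measurable_blockLen.prodMk P.measurable_demand)
  let φ : ℕ → (ℕ → ℝ) → ℝ≥0∞ := fun t u =>
    if P.depth τ u = t then f (P.blockLen τ u, P.demand τ u) else 0
  have hφ : ∀ t, Measurable (φ t) := fun t =>
    Measurable.ite (P.measurable_depth (measurableSet_singleton _)) hX measurable_const
  have hφt : ∀ t u u', (∀ i < t + 1, u i = u' i) → φ t u = φ t u' := fun t u u' h => by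
    have h' : ∀ i ≤ t, u i = u' i := fun i hi => h i (by omega)
    by_cases ht : P.depth τ u = t
    · simp only [φ, ht, P.depth_congr h' ht, blockLen, P.demand_congr h' ht]
    · have ht' : P.depth τ u' ≠ t := fun h2 => ht (P.depth_congr (fun i hi => (h' i hi).symm) h2)
      simp only [φ, ht, ht', if_false]
  have hsum : ∀ (G : ℕ → ℝ≥0∞) u, P.depth τ u < ⊤ →
      ∑' t, φ t u * G t = f (P.blockLen τ u, P.demand τ u) * G (P.depth τ u).toNat := by
    intro G u hu
    obtain ⟨t, ht⟩ := ENat.ne_top_iff_exists.1 hu.ne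
    rw [tsum_eq_single t fun s hs => ?_]
    · simp only [φ, ← ht, if_true, ENat.toNat_natCast]
    · have : P.depth τ u ≠ s := by
        rw [← ht]
        exact_mod_cast hs.symm
      simp only [φ, this, if_false, zero_mul]
  have h1 : ∫⁻ u, f (P.blockLen τ u, P.demand τ u) * g (P.next τ u) ∂unifSeq =
      ∫⁻ u, ∑' t, φ t u * g (shift (t + 1) u) ∂unifSeq :=
    lintegral_congr_ae <| hfin.mono fun u hu => (hsum (fun t => g (shift (t + 1) u)) u hu).symm
  have h2 : ∫⁻ u, f (P.blockLen τ u, P.demand τ u) ∂unifSeq = ∑' t, ∫⁻ u, φ t u ∂unifSeq := by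
    rw [← lintegral_tsum fun t => (hφ t).aemeasurable]
    refine lintegral_congr_ae <| hfin.mono fun u hu => ?_
    simpa using (hsum (fun _ => 1) u hu).symm
  have h3 := lintegral_tsum (μ := unifSeq) (f := fun t u => φ t u * g (shift (t + 1) u))
    fun t => ((hφ t).mul (hg.comp (measurable_shift (t + 1)))).aemeasurable
  rw [h1, h3, h2, ← ENNReal.tsum_mul_right]
  exact tsum_congr fun t => lintegral_mul_comp_shift (hφ t) hg (hφt t)

lemma Ker.measurePreserving_next (hfin : ∀ᵐ u ∂unifSeq, P.depth τ u < ⊤) :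
    MeasurePreserving (P.next τ) unifSeq unifSeq := by
  refine ⟨P.measurable_next, Measure.ext fun s hs => ?_⟩
  have h := P.lintegral_mul_comp_next hfin (fun _ => 1) (measurable_one.indicator hs)
  simp only [one_mul, lintegral_const, measure_univ, mul_one] at h
  rw [Measure.map_apply P.measurable_next hs, ← lintegral_indicator_one hs, ← h,
    ← lintegral_indicator_one (P.measurable_next hs)]
  rfl

lemma Ker.measurePreserving_iterate_next (hfin : ∀ᵐ u ∂unifSeq, P.depth τ u < ⊤) (b : ℕ) :
    MeasurePreserving (P.next τ)^[b] unifSeq unifSeq :=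
  (P.measurePreserving_next hfin).iterate b

variable (P τ) in
/-- The length and the demand of the block number `b`. -/
noncomputable def Ker.block (b : ℕ) (u : ℕ → ℝ) : ℕ × ℕ∞ :=
  (P.blockLen τ ((P.next τ)^[b] u), P.demand τ ((P.next τ)^[b] u))

lemma Ker.measurable_block (b : ℕ) : Measurable (P.block τ b) :=
  (P.measurable_blockLen.prodMk P.measurable_demand).comp (P.measurable_next.iterate b)

lemma Ker.lintegral_prod_block (hfin : ∀ᵐ u ∂unifSeq, P.depth τ u < ⊤) (n : ℕ)
    (f : ℕ → ℕ × ℕ∞ → ℝ≥0∞) :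
    ∫⁻ u, ∏ b ∈ Finset.range n, f b (P.block τ b u) ∂unifSeq =
      ∏ b ∈ Finset.range n, ∫⁻ u, f b (P.block τ 0 u) ∂unifSeq := by
  induction n generalizing f with
  | zero => simp
  | succ n ih =>
    simp only [Finset.prod_range_succ']
    have h := P.lintegral_mul_comp_next hfin (f 0)
      (g := fun u => ∏ b ∈ Finset.range n, f (b + 1) (P.block τ b u))
      (Finset.measurable_fun_prod _ fun b _ =>
        (Measurable.of_discrete (f := f (b + 1))).comp (P.measurable_block b))
    rw [← ih fun b => f (b + 1), mul_comm]
    refine Eq.trans (lintegral_congr fun u => ?_) h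
    rw [mul_comm]
    rfl

lemma Ker.lintegral_block (hfin : ∀ᵐ u ∂unifSeq, P.depth τ u < ⊤) (b : ℕ) (f : ℕ × ℕ∞ → ℝ≥0∞) :
    ∫⁻ u, f (P.block τ b u) ∂unifSeq = ∫⁻ u, f (P.block τ 0 u) ∂unifSeq :=
  (P.measurePreserving_iterate_next hfin b).lintegral_comp
    ((Measurable.of_discrete (f := f)).comp (P.measurable_block 0))

lemma Ker.measure_block (hfin : ∀ᵐ u ∂unifSeq, P.depth τ u < ⊤) (b : ℕ) (s : Set (ℕ × ℕ∞)) :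
    unifSeq (P.block τ b ⁻¹' s) = unifSeq (P.block τ 0 ⁻¹' s) :=
  (P.measurePreserving_iterate_next hfin b).measure_preimage
    (P.measurable_block 0 (MeasurableSet.of_discrete (s := s))).nullMeasurableSet

lemma Ker.iIndepFun_block (hfin : ∀ᵐ u ∂unifSeq, P.depth τ u < ⊤) :
    iIndepFun (P.block τ) unifSeq := by
  classical
  rw [iIndepFun_iff_measure_inter_preimage_eq_mul]
  intro S s _
  obtain ⟨n, hn⟩ := S.exists_nat_subset_range
  have hprod : ∀ c : ℕ → ℝ≥0∞, ∏ b ∈ S, c b = ∏ b ∈ Finset.range n, if b ∈ S then c b else 1 := by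
    intro c
    rw [Finset.prod_ite, Finset.prod_const_one, mul_one, Finset.filter_mem_eq_inter,
      Finset.inter_eq_right.2 hn]
  have hm : ∀ b, MeasurableSet (P.block τ b ⁻¹' s b) := fun b =>
    P.measurable_block b MeasurableSet.of_discrete
  have h := P.lintegral_prod_block hfin n fun b x => if b ∈ S then (s b).indicator 1 x else 1
  have h1 : ∀ b, ∫⁻ u, (if b ∈ S then (s b).indicator 1 (P.block τ 0 u) else 1) ∂unifSeq =
      if b ∈ S then unifSeq (P.block τ b ⁻¹' s b) else 1 := by
    intro b
    split_ifs
    · rw [P.measure_block hfin, ← lintegral_indicator_one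
        (P.measurable_block 0 (MeasurableSet.of_discrete (s := s b)))]
      rfl
    · simp
  simp only [h1, ← hprod] at h
  rw [← h, ← lintegral_indicator_one (Finset.measurableSet_biInter S fun b _ => hm b)]
  refine lintegral_congr fun u => ?_
  by_cases hu : u ∈ ⋂ i ∈ S, P.block τ i ⁻¹' s i
  · rw [Set.indicator_of_mem hu]
    simp only [Set.mem_iInter] at hu
    exact (Finset.prod_eq_one fun b hb =>
      Set.indicator_of_mem (s := s b) (hu b hb) 1).symm
  · rw [Set.indicator_of_notMem hu]
    simp only [Set.mem_iInter, not_forall] at hu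
    obtain ⟨b, hb, hbu⟩ := hu
    exact (Finset.prod_eq_zero hb (Set.indicator_of_notMem (s := s b) hbu 1)).symm

end IndependentBlocks

/-! ### The law of the demand of a block -/

section DemandLaw

variable {A : Type*} [Encodable A] [Nonempty A] {P : Ker A} {τ : ContextTree A}

/-- The integral of a variable with values in `{0, 1, …, ∞}` is the sum of its tail. -/
lemma lintegral_enat_eq_tsum {Ω : Type*} [MeasurableSpace Ω] {μ : Measure Ω} {f : Ω → ℕ∞}
    (hf : Measurable f) :
    ∫⁻ ω, (f ω : ℝ≥0∞) ∂μ = ∑' j : ℕ, μ {ω | ((j + 1 : ℕ) : ℕ∞) ≤ f ω} := by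
  have hm : ∀ j : ℕ, MeasurableSet {ω | ((j + 1 : ℕ) : ℕ∞) ≤ f ω} := fun j =>
    hf (MeasurableSet.of_discrete (s := Set.Ici _))
  have hpt : ∀ x : ℕ∞, (x : ℝ≥0∞) =
      ∑' j : ℕ, if ((j + 1 : ℕ) : ℕ∞) ≤ x then (1 : ℝ≥0∞) else 0 := by
    intro x
    induction x using ENat.recTopCoe with
    | top => simp
    | coe k =>
      rw [tsum_eq_sum (s := Finset.range k) fun j hj => if_neg ?_]
      · rw [Finset.sum_congr rfl fun j hj => if_pos ?_]
        · simp
        · have := Finset.mem_range.1 hj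
          exact_mod_cast this
      · intro h
        have h' : j + 1 ≤ k := by exact_mod_cast h
        exact hj (Finset.mem_range.2 h')
  have : ∀ j : ℕ, μ {ω | ((j + 1 : ℕ) : ℕ∞) ≤ f ω} =
      ∫⁻ ω, (if ((j + 1 : ℕ) : ℕ∞) ≤ f ω then (1 : ℝ≥0∞) else 0) ∂μ := fun j => by
    rw [← lintegral_indicator_one (hm j)]
    refine lintegral_congr fun ω => ?_
    simp [Set.indicator_apply]
  simp only [this]
  rw [← lintegral_tsum fun j => (Measurable.ite (hm j) measurable_const
    measurable_const).aemeasurable]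
  exact lintegral_congr fun ω => hpt _

omit [Nonempty A] in
lemma Ker.depth_eq_zero {u : ℕ → ℝ} (h : ∃ a, P.symbolY (u 0) = some a) : P.depth τ u = 0 := by
  have : P.depth τ u ≤ (0 : ℕ) := iInf_nat_le_iff.2 ⟨0, le_rfl, fun j hj => by
    rw [Nat.le_zero.1 hj]
    exact Or.inl h⟩
  simpa using this

omit [Nonempty A] in
lemma Ker.demand_eq_zero {u : ℕ → ℝ} (h : ∃ a, P.symbolY (u 0) = some a) : P.demand τ u = 0 := by
  have : P.demand τ u ≤ (0 : ℕ) := iInf_nat_le_iff.2 ⟨0, le_rfl, fun j hj => by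
    rw [depth_eq_zero h] at hj
    rw [Nat.le_zero.1 hj]
    exact Or.inl h⟩
  simpa using this

lemma Ker.unif_cell (a : A) :
    unif (cell (Encodable.encode (α := A)) P.alpha a) = ENNReal.ofReal (P.alpha a) := by
  have hsub : cell (Encodable.encode (α := A)) P.alpha a ⊆ Set.Ico 0 1 :=
    Set.Ico_subset_Ico (cellLeft_nonneg P.alpha_nonneg a)
      ((cellLeft_add_le_tsum P.alpha_nonneg P.summable_alpha a).trans P.alphaMinusOne_le_one)
  rw [unif, Measure.restrict_apply (measurableSet_cell _ _ _), Set.inter_eq_left.2 hsub, cell,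
    Real.volume_Ico, add_sub_cancel_left]

lemma Ker.measureReal_symbolY :
    unifSeq.real {u | ∃ a, P.symbolY (u 0) = some a} = P.alphaMinusOne := by
  have h1 : {u : ℕ → ℝ | ∃ a, P.symbolY (u 0) = some a} =
      ⋃ a, (fun u => u 0) ⁻¹' cell (Encodable.encode (α := A)) P.alpha a := by
    ext u
    simp [symbolY_eq_some_iff]
  have hm : ∀ a, MeasurableSet
      ((fun u : ℕ → ℝ => u 0) ⁻¹' cell (Encodable.encode (α := A)) P.alpha a) := fun a =>
    measurable_pi_apply 0 (measurableSet_cell _ _ _)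
  rw [measureReal_def, h1, measure_iUnion _ hm]
  · simp only [(measurePreserving_eval 0).measure_preimage
      (measurableSet_cell _ _ _).nullMeasurableSet, P.unif_cell]
    rw [← ENNReal.ofReal_tsum_of_nonneg P.alpha_nonneg P.summable_alpha,
      ENNReal.toReal_ofReal (tsum_nonneg P.alpha_nonneg)]
    rfl
  · intro a b hab
    exact Set.disjoint_left.2 fun u ha hb => hab
      (eq_of_mem_cell Encodable.encode_injective P.alpha_nonneg P.summable_alpha ha hb)

lemma Ker.alphaMinusOne_le_measureReal_demand (k : ℕ) :
    P.alphaMinusOne ≤ unifSeq.real {u | P.demand τ u ≤ k} := by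
  rw [← P.measureReal_symbolY]
  refine measureReal_mono fun u hu => ?_
  rw [Set.mem_ofPred_eq, demand_eq_zero hu]
  exact zero_le

omit [Nonempty A] in
/-- The level `α_k` is almost surely not attained by the uniform variable, since the maximum context
length takes countably many values. -/
lemma Ker.measure_alphaLen_le_eq (k : ℕ) :
    unifSeq {u | P.alphaLen τ k (P.ctxLen τ (shift 1 u)) ≤ u 0} =
      unifSeq {u | P.alphaLen τ k (P.ctxLen τ (shift 1 u)) < u 0} := by
  refine measure_congr ?_
  have h : ∀ᵐ u ∂unifSeq, ∀ i : ℕ∞, u 0 ≠ P.alphaLen τ k i := by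
    rw [ae_all_iff]
    intro i
    have h0 : ∀ᵐ t ∂unif, t ≠ P.alphaLen τ k i := by
      rw [ae_iff]
      simp [unif]
    exact (measurePreserving_eval 0).quasiMeasurePreserving.ae h0
  filter_upwards [h] with u hu
  exact propext ⟨fun h1 => lt_of_le_of_ne h1 (hu _).symm, fun h1 => le_of_lt h1⟩

/-- The demand of a block exceeds `k` only if, in one of the positions of the block, the uniform
variable is above the level `α_k`; the event that a position belongs to the block is independent of
the uniform variables of this position and of the older ones. -/
lemma Ker.measure_demand_gt_le (k : ℕ) :
    unifSeq {u | (k : ℕ∞) < P.demand τ u} ≤ (∫⁻ u, (P.depth τ u : ℝ≥0∞) ∂unifSeq + 1) *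
      unifSeq {u | P.alphaLen τ k (P.ctxLen τ (shift 1 u)) < u 0} := by
  have hB : MeasurableSet {u | P.alphaLen τ k (P.ctxLen τ (shift 1 u)) ≤ u 0} :=
    measurableSet_le (P.measurable_alphaLen_ctxLen k 1) (measurable_pi_apply 0)
  have hD : ∀ j : ℕ, MeasurableSet {u | (j : ℕ∞) ≤ P.depth τ u} := fun j =>
    P.measurable_depth (MeasurableSet.of_discrete (s := Set.Ici _))
  have hsub : {u | (k : ℕ∞) < P.demand τ u} ⊆ ⋃ j : ℕ, {u | (j : ℕ∞) ≤ P.depth τ u} ∩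
      shift j ⁻¹' {u | P.alphaLen τ k (P.ctxLen τ (shift 1 u)) ≤ u 0} := by
    intro u hu
    have hnot : ¬ P.BelowLevel τ k (P.depth τ u).toNat u := fun h =>
      absurd (iInf_nat_le_iff.2 ⟨k, le_rfl, h⟩) (not_le.2 hu)
    simp only [BelowLevel, not_forall, not_or, not_lt] at hnot
    obtain ⟨j, hj, -, hle⟩ := hnot
    refine Set.mem_iUnion.2 ⟨j, ?_, ?_⟩
    · exact le_trans (by exact_mod_cast hj) (ENat.natCast_toNat_le_self _)
    · rw [Set.mem_preimage, Set.mem_ofPred_eq, shift_shift]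
      exact hle
  have hterm : ∀ j : ℕ, unifSeq ({u | (j : ℕ∞) ≤ P.depth τ u} ∩
      shift j ⁻¹' {u | P.alphaLen τ k (P.ctxLen τ (shift 1 u)) ≤ u 0}) =
      unifSeq {u | (j : ℕ∞) ≤ P.depth τ u} *
        unifSeq {u | P.alphaLen τ k (P.ctxLen τ (shift 1 u)) < u 0} := by
    intro j
    have h := lintegral_mul_comp_shift (n := j)
      (f := Set.indicator {u | (j : ℕ∞) ≤ P.depth τ u} 1)
      (g := Set.indicator {u | P.alphaLen τ k (P.ctxLen τ (shift 1 u)) ≤ u 0} 1)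
      (measurable_one.indicator (hD j)) (measurable_one.indicator hB) (fun u u' huu => ?_)
    · rw [lintegral_indicator_one (hD j), lintegral_indicator_one hB, measure_alphaLen_le_eq] at h
      rw [← h, ← lintegral_indicator_one ((hD j).inter (measurable_shift j hB)),
        Set.inter_indicator_one]
      rfl
    · have hiff : (j : ℕ∞) ≤ P.depth τ u ↔ (j : ℕ∞) ≤ P.depth τ u' := by
        cases j with
        | zero => simp
        | succ i =>
          have := P.depth_le_congr (τ := τ) (u := u) (u' := u') (k := i)
            fun r hr => huu r (by omega)
          rw [← not_lt, ← not_lt, Nat.cast_add, Nat.cast_one,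
            ENat.lt_add_one_iff (ENat.natCast_ne_top i),
            ENat.lt_add_one_iff (ENat.natCast_ne_top i), this]
      simp only [Set.indicator_apply, Set.mem_ofPred_eq, hiff, Pi.one_apply]
  calc unifSeq {u | (k : ℕ∞) < P.demand τ u}
      ≤ ∑' j : ℕ, unifSeq ({u | (j : ℕ∞) ≤ P.depth τ u} ∩
          shift j ⁻¹' {u | P.alphaLen τ k (P.ctxLen τ (shift 1 u)) ≤ u 0}) :=
        (measure_mono hsub).trans (measure_iUnion_le _)
    _ = (∑' j : ℕ, unifSeq {u | (j : ℕ∞) ≤ P.depth τ u}) *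
          unifSeq {u | P.alphaLen τ k (P.ctxLen τ (shift 1 u)) < u 0} := by
        rw [← ENNReal.tsum_mul_right]
        exact tsum_congr hterm
    _ = _ := by
        rw [tsum_eq_zero_add' ENNReal.summable, lintegral_enat_eq_tsum P.measurable_depth, add_comm]
        simp

end DemandLaw

/-! ### Transfer to the sequence of uniform variables -/

section Transfer

variable {Ω : Type*} [MeasurableSpace Ω] {μ : Measure Ω} {U : ℤ → Ω → ℝ}
  {A : Type*} [Encodable A] [Nonempty A] {P : Ker A} {τ : ContextTree A}

lemma IsIIDUniform.measure_le (hU : IsIIDUniform μ U) (n : ℤ) {s : Set Ω} {B : Set (ℕ → ℝ)}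
    (hB : MeasurableSet B) (h : ∀ᵐ ω ∂μ, ω ∈ s → backward (fun i => U i ω) n ∈ B) :
    μ s ≤ unifSeq B := by
  rw [← hU.map_backward n, Measure.map_apply (measurable_backward hU.measurable n) hB]
  exact measure_mono_ae h

lemma IsIIDUniform.measure_eq (hU : IsIIDUniform μ U) (n : ℤ) {B : Set (ℕ → ℝ)}
    (hB : MeasurableSet B) : μ {ω | backward (fun i => U i ω) n ∈ B} = unifSeq B := by
  rw [← hU.map_backward n, Measure.map_apply (measurable_backward hU.measurable n) hB]
  rfl

lemma IsIIDUniform.ae_backward (hU : IsIIDUniform μ U) (n : ℤ) {p : (ℕ → ℝ) → Prop}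
    (h : ∀ᵐ u ∂unifSeq, p u) : ∀ᵐ ω ∂μ, p (backward (fun i => U i ω) n) := by
  rw [← hU.map_backward n] at h
  exact ae_of_ae_map (measurable_backward hU.measurable n).aemeasurable h

lemma Ker.meanThetaBar_eq (hU : IsIIDUniform μ U) :
    Ker.meanThetaBar μ U P τ = ∫⁻ u, (P.depth τ u : ℝ≥0∞) ∂unifSeq := by
  have hm : Measurable fun u => (P.depth τ u : ℝ≥0∞) :=
    (Measurable.of_discrete (f := fun x : ℕ∞ => (x : ℝ≥0∞))).comp P.measurable_depth
  rw [← hU.map_backward 0, lintegral_map hm (measurable_backward hU.measurable 0)]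
  simp only [meanThetaBar, absThetaBar_eq]

lemma Ker.tail_absThetaBar_eq (hU : IsIIDUniform μ U) (n : ℕ) :
    tail μ (fun ω => P.absThetaBar τ (fun i => U i ω)) n =
      unifSeq.real {u | (n : ℕ∞) ≤ P.depth τ u} := by
  have hm : MeasurableSet {u | (n : ℕ∞) ≤ P.depth τ u} :=
    P.measurable_depth (MeasurableSet.of_discrete (s := Set.Ici _))
  simp only [tail, absThetaBar_eq, measureReal_def]
  rw [← hU.measure_eq 0 hm]
  rfl

omit [Nonempty A] in
lemma Ker.alphaMinusOne_le_seqA (k : ℕ) : P.alphaMinusOne ≤ Ker.seqA μ U P τ k := by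
  rw [seqA]
  split_ifs
  exacts [le_rfl, le_max_right _ _]

lemma Ker.seqA_le_one (k : ℕ) : Ker.seqA μ U P τ k ≤ 1 := by
  rw [seqA]
  split_ifs
  · exact P.alphaMinusOne_le_one
  · exact max_le (sub_le_self 1 (mul_nonneg (by positivity) measureReal_nonneg))
      P.alphaMinusOne_le_one

/-- The numbers `A_k` are lower bounds for the distribution function of the demand of a block. -/
lemma Ker.seqA_le (hU : IsIIDUniform μ U) (hgood : Ker.IsGood μ U P τ) (k : ℕ) :
    Ker.seqA μ U P τ k ≤ unifSeq.real {u | P.demand τ u ≤ k} := by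
  rw [seqA]
  split_ifs
  · exact P.alphaMinusOne_le_measureReal_demand k
  · refine max_le ?_ (P.alphaMinusOne_le_measureReal_demand k)
    have hm : MeasurableSet {u | P.alphaLen τ k (P.ctxLen τ (shift 1 u)) < u 0} :=
      measurableSet_lt (P.measurable_alphaLen_ctxLen k 1) (measurable_pi_apply 0)
    have h1 : μ {ω | P.alphaLen τ k (P.maxCtxLength τ (fun i => U i ω) (-1)) < U 0 ω} =
        unifSeq {u | P.alphaLen τ k (P.ctxLen τ (shift 1 u)) < u 0} := by
      rw [← hU.measure_eq 0 hm]
      simp [maxCtxLength_eq, shift_backward, backward]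
    have h2 := P.measure_demand_gt_le (τ := τ) k
    rw [← h1, ← meanThetaBar_eq hU] at h2
    have hfinite : (Ker.meanThetaBar μ U P τ + 1) *
        μ {ω | P.alphaLen τ k (P.maxCtxLength τ (fun i => U i ω) (-1)) < U 0 ω} ≠ ⊤ := by
      rw [h1]
      exact ENNReal.mul_ne_top (ENNReal.add_ne_top.2 ⟨hgood.ne, ENNReal.one_ne_top⟩)
        (measure_ne_top _ _)
    have h3 := ENNReal.toReal_mono hfinite h2
    rw [ENNReal.toReal_mul, ENNReal.toReal_add hgood.ne ENNReal.one_ne_top,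
      ENNReal.toReal_one] at h3
    have hmd : MeasurableSet {u | P.demand τ u ≤ k} :=
      P.measurable_demand (MeasurableSet.of_discrete (s := Set.Iic _))
    have h4 : {u | (k : ℕ∞) < P.demand τ u} = {u | P.demand τ u ≤ k}ᶜ := by
      ext u
      simp
    rw [h4, ← measureReal_def, probReal_compl_eq_one_sub hmd, ← measureReal_def] at h3
    linarith

lemma Ker.ae_depth_lt_top (hU : IsIIDUniform μ U) (hgood : Ker.IsGood μ U P τ) :
    ∀ᵐ u ∂unifSeq, P.depth τ u < ⊤ := by
  have hm : Measurable fun u => (P.depth τ u : ℝ≥0∞) :=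
    (Measurable.of_discrete (f := fun x : ℕ∞ => (x : ℝ≥0∞))).comp P.measurable_depth
  rw [IsGood, meanThetaBar_eq hU] at hgood
  filter_upwards [ae_lt_top hm hgood.ne] with u hu
  simpa using hu

end Transfer

/-! ### Coalescence at the first renewal -/

section Coalescence

variable {A : Type*} [Encodable A] [Nonempty A] {P : Ker A} {τ : ContextTree A}

variable (P τ) in
/-- The event that there is no renewal among the first `n` blocks. -/
def Ker.noBlockRenewal (n : ℕ) : Set (ℕ → ℝ) := noRenewal (fun b u => (P.block τ b u).2) n

omit [Nonempty A] in
lemma Ker.measurableSet_noBlockRenewal {n : ℕ} {S : Set ℕ} (hS : ∀ b < n, b ∈ S) :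
    MeasurableSet[⨆ b ∈ S, MeasurableSpace.comap (P.block τ b) inferInstance]
      (P.noBlockRenewal τ n) :=
  ChainsInfiniteOrder.measurableSet_noRenewal hS fun _ =>
    measurable_snd.comp (comap_measurable _)

lemma Ker.comap_block_le (b : ℕ) :
    MeasurableSpace.comap (P.block τ b) inferInstance ≤ MeasurableSpace.pi :=
  (P.measurable_block b).comap_le

lemma Ker.measurableSet_noBlockRenewal' (n : ℕ) : MeasurableSet (P.noBlockRenewal τ n) :=
  iSup₂_le (fun b _ => P.comap_block_le b) _
    (P.measurableSet_noBlockRenewal (S := Set.univ) fun _ _ => trivial)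

omit [Nonempty A] in
lemma Ker.noBlockRenewal_zero : P.noBlockRenewal τ 0 = Set.univ :=
  Set.eq_univ_of_forall fun _ k h1 h2 => absurd (h1.trans h2) (by omega)

omit [Nonempty A] in
lemma Ker.totalLen_mono (u : ℕ → ℝ) : Monotone fun n => P.totalLen τ n u := fun _ _ h =>
  Finset.sum_le_sum_of_subset (Finset.range_mono h)

variable (P τ) in
/-- The symbol in position `0` does not depend on the past before position `l`. -/
def Ker.Coalesces (u : ℕ → ℝ) (l : ℕ) : Prop :=
  ∀ x y, run (P.update τ) x (l + 1) u 0 = run (P.update τ) y (l + 1) u 0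

lemma Ker.Coalesces.lag_le {U : ℤ → ℝ} {l : ℕ} (h : P.Coalesces τ (backward U 0) l) :
    absTheta (P.update τ) U ≤ l := by
  refine iInf₂_le l fun i hi x y => ?_
  obtain rfl : i = 0 := le_antisymm hi.2 hi.1
  rw [iterF_eq_run, iterF_eq_run]
  exact h x y

lemma Ker.exists_coalesces (hLC : P.LocallyContinuous τ) {u : ℕ → ℝ}
    (hd : ∀ b, P.depth τ ((P.next τ)^[b] u) < ⊤) {c : ℕ} (hc : u ∉ P.noBlockRenewal τ c) :
    ∃ l < P.totalLen τ c u, P.Coalesces τ u l := by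
  simp only [noBlockRenewal, noRenewal, Set.mem_ofPred_eq, not_forall, not_exists, not_and,
    not_lt] at hc
  obtain ⟨n, hn1, hnc, hn⟩ := hc
  have hpos : 0 < P.totalLen τ n u := lt_of_lt_of_le hn1 (P.le_totalLen n u)
  refine ⟨P.totalLen τ n u - 1,
    (Nat.sub_lt hpos one_pos).trans_le (P.totalLen_mono u hnc), fun x y => ?_⟩
  rw [show P.totalLen τ n u - 1 + 1 = P.totalLen τ n u by omega]
  exact P.run_totalLen_congr hLC (fun b _ => hd b) hn x y 0 hpos

lemma Ker.ae_forall_depth_lt_top (hfin : ∀ᵐ u ∂unifSeq, P.depth τ u < ⊤) :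
    ∀ᵐ u ∂unifSeq, ∀ b, P.depth τ ((P.next τ)^[b] u) < ⊤ :=
  ae_all_iff.2 fun b =>
    (P.measurePreserving_iterate_next hfin b).quasiMeasurePreserving.ae hfin

lemma Ker.ae_exists_coalesces (hLC : P.LocallyContinuous τ)
    (hfin : ∀ᵐ u ∂unifSeq, P.depth τ u < ⊤)
    (hr : Tendsto (fun n => unifSeq.real (P.noBlockRenewal τ n)) atTop (𝓝 0)) :
    ∀ᵐ u ∂unifSeq, ∃ l, P.Coalesces τ u l := by
  have h0 : unifSeq.real (⋂ n, P.noBlockRenewal τ n) = 0 :=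
    le_antisymm (ge_of_tendsto' hr fun n => measureReal_mono (Set.iInter_subset _ n))
      measureReal_nonneg
  rw [measureReal_eq_zero_iff] at h0
  filter_upwards [P.ae_forall_depth_lt_top hfin, measure_eq_zero_iff_ae_notMem.1 h0] with u hd hu
  rw [Set.mem_iInter, not_forall] at hu
  obtain ⟨c, hc⟩ := hu
  obtain ⟨l, -, hl⟩ := P.exists_coalesces hLC hd hc
  exact ⟨l, hl⟩

lemma Ker.feasible_of_ae_coalesces {Ω : Type*} [MeasurableSpace Ω] {μ : Measure Ω}
    {U : ℤ → Ω → ℝ} (hU : IsIIDUniform μ U) (h : ∀ᵐ u ∂unifSeq, ∃ l, P.Coalesces τ u l) :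
    Feasible μ U (P.update τ) := by
  intro m n _
  filter_upwards [ae_all_iff.2 fun i : ℤ => hU.ae_backward i h] with ω hω
  choose l hl using hω
  -- a starting time that is early enough for all the times between `m` and `n`
  refine lt_of_le_of_lt (iInf₂_le (∑ i ∈ Finset.Icc m n, l i) fun i hi x y => ?_)
    (ENat.natCast_lt_top _)
  have hli : l i ≤ ∑ i ∈ Finset.Icc m n, l i :=
    Finset.single_le_sum (f := l) (fun _ _ => Nat.zero_le _) (Finset.mem_Icc.2 hi)
  have hstart : m - ((∑ i ∈ Finset.Icc m n, l i : ℕ) : ℤ) =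
      i - (((i - m).toNat + ∑ i ∈ Finset.Icc m n, l i : ℕ) : ℤ) := by
    have := hi.1
    omega
  rw [hstart]
  refine iterF_congr_of_le (hli.trans (Nat.le_add_left _ _)) (fun x y => ?_) x y
  rw [iterF_eq_run, iterF_eq_run]
  exact hl i x y

end Coalescence

/-! ### Tails of the coalescence time -/

section Tails

variable {A : Type*} [Encodable A] [Nonempty A] {P : Ker A} {τ : ContextTree A}

lemma Ker.measureReal_noBlockRenewal_succ (hfin : ∀ᵐ u ∂unifSeq, P.depth τ u < ⊤) (n : ℕ) :
    unifSeq.real (P.noBlockRenewal τ (n + 1)) = ∑ k ∈ Finset.range (n + 1),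
      (∏ j ∈ Finset.range k, unifSeq.real {u | P.demand τ u ≤ j} -
        ∏ j ∈ Finset.range (k + 1), unifSeq.real {u | P.demand τ u ≤ j}) *
        unifSeq.real (P.noBlockRenewal τ (n - k)) :=
  ChainsInfiniteOrder.measureReal_noRenewal_succ P.comap_block_le
    (P.iIndepFun_block hfin).iIndep (fun _ => measurable_snd.comp (comap_measurable _))
    (fun b j => congrArg ENNReal.toReal (P.measure_block hfin b {x | x.2 ≤ j})) n

omit [Nonempty A] in
lemma Ker.lintegral_blockLen (hfin : ∀ᵐ u ∂unifSeq, P.depth τ u < ⊤) :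
    ∫⁻ u, (P.blockLen τ u : ℝ≥0∞) ∂unifSeq = ∫⁻ u, (P.depth τ u : ℝ≥0∞) ∂unifSeq + 1 := by
  have h1 : ∫⁻ u, (P.blockLen τ u : ℝ≥0∞) ∂unifSeq =
      ∫⁻ u, ((P.depth τ u : ℝ≥0∞) + 1) ∂unifSeq := by
    refine lintegral_congr_ae (hfin.mono fun u hu => ?_)
    obtain ⟨t, ht⟩ := ENat.ne_top_iff_exists.1 hu.ne
    simp [blockLen, ← ht]
  rw [h1, lintegral_add_right _ measurable_const]
  simp

variable (P τ) in
/-- The number of positions in the blocks up to the first renewal. -/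
noncomputable def Ker.renewalLen (u : ℕ → ℝ) : ℝ≥0∞ :=
  ∑' b, (P.noBlockRenewal τ b).indicator 1 u * ((P.block τ b u).1 : ℝ≥0∞)

lemma Ker.measurable_renewalLen : Measurable (P.renewalLen τ) :=
  Measurable.tsum fun b =>
    (measurable_one.indicator (P.measurableSet_noBlockRenewal' b)).mul
      ((Measurable.of_discrete (f := fun x : ℕ × ℕ∞ => (x.1 : ℝ≥0∞))).comp (P.measurable_block b))

/-- Wald's identity: whether a renewal has occurred before a block is independent of the length of
this block. -/
lemma Ker.lintegral_renewalLen (hfin : ∀ᵐ u ∂unifSeq, P.depth τ u < ⊤) :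
    ∫⁻ u, P.renewalLen τ u ∂unifSeq =
      (∑' b, unifSeq (P.noBlockRenewal τ b)) * ∫⁻ u, (P.blockLen τ u : ℝ≥0∞) ∂unifSeq := by
  have hlen : ∀ b, Measurable fun u => ((P.block τ b u).1 : ℝ≥0∞) := fun b =>
    (Measurable.of_discrete (f := fun x : ℕ × ℕ∞ => (x.1 : ℝ≥0∞))).comp (P.measurable_block b)
  simp only [renewalLen]
  have htsum := lintegral_tsum (μ := unifSeq)
    (f := fun b u => (P.noBlockRenewal τ b).indicator 1 u * ((P.block τ b u).1 : ℝ≥0∞))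
    fun b => ((measurable_one.indicator
      (P.measurableSet_noBlockRenewal' b)).mul (hlen b)).aemeasurable
  rw [htsum, ← ENNReal.tsum_mul_right]
  refine tsum_congr fun b => ?_
  have hdisj : Disjoint {i | i < b} {b} := Set.disjoint_singleton_right.2 (lt_irrefl b)
  have hind : Measurable[⨆ i ∈ {i | i < b}, MeasurableSpace.comap (P.block τ i) inferInstance]
      ((P.noBlockRenewal τ b).indicator (1 : (ℕ → ℝ) → ℝ≥0∞)) := by
    apply Measurable.indicator
    · exact @measurable_const _ _ _ (_) (1 : ℝ≥0∞)
    · exact P.measurableSet_noBlockRenewal fun i hi => hi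
  have h := lintegral_mul_eq_lintegral_mul_lintegral_of_independent_measurableSpace
    (iSup₂_le fun i _ => P.comap_block_le i) (iSup₂_le fun i _ => P.comap_block_le i)
    (indep_iSup_of_disjoint P.comap_block_le (P.iIndepFun_block hfin).iIndep hdisj)
    (f := (P.noBlockRenewal τ b).indicator 1) (g := fun u => ((P.block τ b u).1 : ℝ≥0∞))
    hind
    ((Measurable.of_discrete (f := fun x : ℕ × ℕ∞ => (x.1 : ℝ≥0∞))).comp
      ((comap_measurable (P.block τ b)).mono (le_iSup₂_of_le (f := fun i (_ : i ∈ ({b} : Set ℕ)) =>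
        MeasurableSpace.comap (P.block τ i) inferInstance) b rfl le_rfl) le_rfl))
  rw [h, lintegral_indicator_one (P.measurableSet_noBlockRenewal' b),
    P.lintegral_block hfin b fun x => (x.1 : ℝ≥0∞)]
  rfl

lemma Ker.natCast_le_renewalLen (hLC : P.LocallyContinuous τ) {U : ℤ → ℝ}
    (hd : ∀ b, P.depth τ ((P.next τ)^[b] (backward U 0)) < ⊤) {n : ℕ}
    (hn : (n : ℕ∞) ≤ absTheta (P.update τ) U) : (n : ℝ≥0∞) ≤ P.renewalLen τ (backward U 0) := by
  classical
  by_cases hex : ∃ c, backward U 0 ∉ P.noBlockRenewal τ c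
  · obtain ⟨l, hl, hcoal⟩ := P.exists_coalesces hLC hd (Nat.find_spec hex)
    have h1 : n ≤ P.totalLen τ (Nat.find hex) (backward U 0) := by
      have : n ≤ l := by exact_mod_cast hn.trans hcoal.lag_le
      omega
    calc (n : ℝ≥0∞) ≤ (P.totalLen τ (Nat.find hex) (backward U 0) : ℝ≥0∞) := by exact_mod_cast h1
      _ = ∑ b ∈ Finset.range (Nat.find hex), (P.noBlockRenewal τ b).indicator 1 (backward U 0) *
            ((P.block τ b (backward U 0)).1 : ℝ≥0∞) := by
          rw [totalLen, Nat.cast_sum]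
          refine Finset.sum_congr rfl fun b hb => ?_
          rw [Set.indicator_of_mem
            (not_not.1 (Nat.find_min hex (Finset.mem_range.1 hb))), Pi.one_apply, one_mul]
          rfl
      _ ≤ _ := ENNReal.sum_le_tsum _
  · push Not at hex
    have htop : P.renewalLen τ (backward U 0) = ⊤ := by
      refine top_le_iff.1 ?_
      rw [← ENNReal.tsum_const_eq_top_of_ne_zero (α := ℕ) one_ne_zero]
      refine ENNReal.tsum_le_tsum fun b => ?_
      rw [Set.indicator_of_mem (hex b), Pi.one_apply, one_mul]
      exact_mod_cast Nat.le_add_left 1 _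
    rw [htop]
    exact le_top

/-- The tail of a variable with finite mean is summable. -/
lemma tsum_measure_le_lintegral {Ω : Type*} [MeasurableSpace Ω] {μ : Measure Ω} {W : Ω → ℝ≥0∞}
    (hW : Measurable W) :
    ∑' n : ℕ, μ {ω | ((n + 1 : ℕ) : ℝ≥0∞) ≤ W ω} ≤ ∫⁻ ω, W ω ∂μ := by
  have hm : ∀ n : ℕ, MeasurableSet {ω | ((n + 1 : ℕ) : ℝ≥0∞) ≤ W ω} := fun n =>
    measurableSet_le measurable_const hW
  simp only [← lintegral_indicator_one (hm _)]
  rw [← lintegral_tsum fun n => (measurable_one.indicator (hm n)).aemeasurable]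
  refine lintegral_mono fun ω => ENNReal.tsum_le_of_sum_range_le fun N => ?_
  induction N with
  | zero => simp
  | succ N ih =>
    by_cases hN : ((N + 1 : ℕ) : ℝ≥0∞) ≤ W ω
    · refine le_trans (Finset.sum_le_card_nsmul _ _ 1 fun n _ => ?_) (by simpa using hN)
      exact Set.indicator_le_self' (fun _ _ => zero_le) ω |>.trans le_rfl
    · rw [Finset.sum_range_succ, Set.indicator_of_notMem (s := {ω | ((N + 1 : ℕ) : ℝ≥0∞) ≤ W ω}) hN,
        add_zero]
      exact ih

lemma Ker.summable_tail_absTheta (hLC : P.LocallyContinuous τ)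
    {Ω : Type*} [MeasurableSpace Ω] {μ : Measure Ω} [IsProbabilityMeasure μ] {U : ℤ → Ω → ℝ}
    (hU : IsIIDUniform μ U) (hgood : Ker.IsGood μ U P τ)
    (hr : Summable fun n => unifSeq.real (P.noBlockRenewal τ n)) :
    Summable (tail μ fun ω => absTheta (P.update τ) fun i => U i ω) := by
  have hfin := P.ae_depth_lt_top hU hgood
  have hint : ∫⁻ u, P.renewalLen τ u ∂unifSeq ≠ ⊤ := by
    rw [P.lintegral_renewalLen hfin, P.lintegral_blockLen hfin, ← Ker.meanThetaBar_eq hU]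
    refine ENNReal.mul_ne_top ?_ (ENNReal.add_ne_top.2 ⟨hgood.ne, ENNReal.one_ne_top⟩)
    simpa only [ofReal_measureReal (measure_ne_top _ _)] using hr.tsum_ofReal_ne_top
  have hsum : Summable fun n : ℕ =>
      (unifSeq {u | ((n + 1 : ℕ) : ℝ≥0∞) ≤ P.renewalLen τ u}).toReal :=
    ENNReal.summable_toReal (ne_top_of_le_ne_top hint
      (tsum_measure_le_lintegral P.measurable_renewalLen))
  rw [← summable_nat_add_iff 1]
  refine Summable.of_nonneg_of_le (fun n => measureReal_nonneg) (fun n => ?_) hsum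
  refine ENNReal.toReal_mono (measure_ne_top _ _) (hU.measure_le 0
    (measurableSet_le measurable_const P.measurable_renewalLen) ?_)
  filter_upwards [hU.ae_backward 0 (P.ae_forall_depth_lt_top hfin)] with ω hω hn
  exact P.natCast_le_renewalLen hLC hω hn

lemma DecaysExponentially.mono {c c' : ℕ → ℝ} (h : DecaysExponentially c')
    (hc : ∀ n, c n ≤ c' n) : DecaysExponentially c := by
  obtain ⟨D, d, hD, hd0, hd1, h⟩ := h
  exact ⟨D, d, hD, hd0, hd1, fun n => (hc n).trans (h n)⟩

lemma DecaysExponentially.add {c c' : ℕ → ℝ} (h : DecaysExponentially c)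
    (h' : DecaysExponentially c') : DecaysExponentially fun n => c n + c' n := by
  obtain ⟨D, d, hD, hd0, hd1, h⟩ := h
  obtain ⟨D', d', hD', hd0', hd1', h'⟩ := h'
  refine ⟨D + D', max d d', by positivity, lt_max_of_lt_left hd0, max_lt hd1 hd1', fun n => ?_⟩
  calc c n + c' n ≤ D * d ^ n + D' * d' ^ n := add_le_add (h n) (h' n)
    _ ≤ D * max d d' ^ n + D' * max d d' ^ n := by
        gcongr
        exacts [le_max_left _ _, le_max_right _ _]
    _ = (D + D') * max d d' ^ n := by ring

lemma decaysExponentially_pow_div {ρ : ℝ} (h0 : 0 < ρ) (h1 : ρ < 1) {q : ℕ} (hq : 0 < q) :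
    DecaysExponentially fun n => ρ ^ (n / q) := by
  have hpow : (ρ ^ ((q : ℝ)⁻¹)) ^ q = ρ := Real.rpow_inv_natCast_pow h0.le hq.ne'
  have hγ0 : 0 < ρ ^ ((q : ℝ)⁻¹) := Real.rpow_pos_of_pos h0 _
  have hγ1 : ρ ^ ((q : ℝ)⁻¹) < 1 := Real.rpow_lt_one h0.le h1 (by positivity)
  refine ⟨ρ⁻¹, ρ ^ ((q : ℝ)⁻¹), by positivity, hγ0, hγ1, fun n => ?_⟩
  rw [inv_mul_eq_div, le_div_iff₀ h0]
  calc ρ ^ (n / q) * ρ = (ρ ^ ((q : ℝ)⁻¹)) ^ (q * (n / q + 1)) := by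
        rw [pow_mul, hpow, pow_succ]
    _ ≤ (ρ ^ ((q : ℝ)⁻¹)) ^ n :=
        pow_le_pow_of_le_one hγ0.le hγ1.le (Nat.lt_mul_div_succ n hq).le

lemma Ker.lintegral_pow_totalLen (hfin : ∀ᵐ u ∂unifSeq, P.depth τ u < ⊤) (s : ℝ≥0∞) (c : ℕ) :
    ∫⁻ u, s ^ P.totalLen τ c u ∂unifSeq = (∫⁻ u, s ^ P.blockLen τ u ∂unifSeq) ^ c := by
  have h := P.lintegral_prod_block hfin c fun _ x => s ^ x.1
  rw [Finset.prod_const, Finset.card_range] at h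
  simp only [Finset.prod_pow_eq_pow_sum] at h
  exact h

lemma Ker.measurable_totalLen (c : ℕ) : Measurable (P.totalLen τ c) :=
  Finset.measurable_fun_sum _ fun b _ => P.measurable_blockLen.comp (P.measurable_next.iterate b)

/-- An exponential moment of the length of a block. -/
lemma Ker.exists_lintegral_pow_blockLen
    (h : DecaysExponentially fun n => unifSeq.real {u | (n : ℕ∞) ≤ P.depth τ u}) :
    ∃ s : ℝ, 1 < s ∧ ∫⁻ u, ENNReal.ofReal s ^ P.blockLen τ u ∂unifSeq ≠ ⊤ := by
  obtain ⟨D, d, hD, hd0, hd1, hd⟩ := h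
  obtain ⟨s, hs1, hs⟩ : ∃ s : ℝ, 1 < s ∧ s < d⁻¹ := exists_between ((one_lt_inv₀ hd0).2 hd1)
  have hsd : d * s < 1 := by rwa [mul_comm, ← lt_inv_mul_iff₀' hd0, mul_one]
  have hs0 : 0 < s := by linarith
  refine ⟨s, hs1, ?_⟩
  have hm : ∀ t : ℕ, MeasurableSet {u | (t : ℕ∞) ≤ P.depth τ u} := fun t =>
    P.measurable_depth (MeasurableSet.of_discrete (s := Set.Ici _))
  have hpt : ∀ u, ENNReal.ofReal s ^ P.blockLen τ u ≤
      ∑' t : ℕ, ENNReal.ofReal s ^ (t + 1) * {u | (t : ℕ∞) ≤ P.depth τ u}.indicator 1 u := by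
    intro u
    refine le_trans (le_of_eq ?_) (ENNReal.le_tsum (P.depth τ u).toNat)
    rw [Set.indicator_of_mem (s := {u | (((P.depth τ _).toNat : ℕ) : ℕ∞) ≤ P.depth τ u})
      (ENat.natCast_toNat_le_self _), Pi.one_apply, mul_one, blockLen]
  refine ne_top_of_le_ne_top ?_ (lintegral_mono hpt)
  rw [lintegral_tsum fun t =>
    ((measurable_one.indicator (hm t)).const_mul (ENNReal.ofReal s ^ (t + 1))).aemeasurable]
  have hterm : ∀ t : ℕ, ∫⁻ u, ENNReal.ofReal s ^ (t + 1) *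
      {u | (t : ℕ∞) ≤ P.depth τ u}.indicator 1 u ∂unifSeq ≤
        ENNReal.ofReal (D * s * (d * s) ^ t) := by
    intro t
    rw [lintegral_const_mul _ (measurable_one.indicator (hm t)), lintegral_indicator_one (hm t),
      ← ofReal_measureReal, ← ENNReal.ofReal_pow hs0.le, ← ENNReal.ofReal_mul (by positivity)]
    refine ENNReal.ofReal_le_ofReal ?_
    calc s ^ (t + 1) * unifSeq.real {u | (t : ℕ∞) ≤ P.depth τ u}
        ≤ s ^ (t + 1) * (D * d ^ t) := by gcongr; exact hd t
      _ = D * s * (d * s) ^ t := by rw [mul_pow, pow_succ]; ring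
  refine ne_top_of_le_ne_top ?_ (ENNReal.tsum_le_tsum hterm)
  exact ((summable_geometric_of_lt_one (by positivity) hsd).mul_left (D * s)).tsum_ofReal_ne_top

/-- Chernoff's bound: the number of positions in a small fraction of `n` blocks exceeds `n` with
exponentially small probability. -/
lemma Ker.exists_decaysExponentially_totalLen (hfin : ∀ᵐ u ∂unifSeq, P.depth τ u < ⊤)
    (h : DecaysExponentially fun n => unifSeq.real {u | (n : ℕ∞) ≤ P.depth τ u}) :
    ∃ q : ℕ, 0 < q ∧
      DecaysExponentially fun n => unifSeq.real {u | n ≤ P.totalLen τ (n / q) u} := by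
  obtain ⟨s, hs1, hK⟩ := P.exists_lintegral_pow_blockLen h
  have hs0 : 0 < s := by linarith
  set K : ℝ := (∫⁻ u, ENNReal.ofReal s ^ P.blockLen τ u ∂unifSeq).toReal with hKdef
  have hK0 : 0 ≤ K := ENNReal.toReal_nonneg
  obtain ⟨q, hq⟩ := pow_unbounded_of_one_lt (K ^ 2) hs1
  have hq' : K ^ 2 ≤ s ^ (q + 1) := hq.le.trans (pow_le_pow_right₀ hs1.le q.le_succ)
  have hsq1 : 1 < √s := by rwa [Real.lt_sqrt zero_le_one, one_pow]
  refine ⟨q + 1, q.succ_pos, 1, (√s)⁻¹, one_pos, by positivity, inv_lt_one_of_one_lt₀ hsq1,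
    fun n => ?_⟩
  set c := n / (q + 1) with hc
  have h1 : ENNReal.ofReal s ^ n * unifSeq {u | n ≤ P.totalLen τ c u} ≤
      (∫⁻ u, ENNReal.ofReal s ^ P.blockLen τ u ∂unifSeq) ^ c := by
    rw [← P.lintegral_pow_totalLen hfin]
    refine le_trans ?_ (mul_meas_ge_le_lintegral (μ := unifSeq)
      ((Measurable.of_discrete (f := fun k : ℕ => ENNReal.ofReal s ^ k)).comp
        (P.measurable_totalLen c)) (ENNReal.ofReal s ^ n))
    refine mul_le_mul_right (measure_mono fun u hu => ?_) _
    exact pow_le_pow_right₀ (ENNReal.one_le_ofReal.2 hs1.le) hu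
  have h2 : s ^ n * unifSeq.real {u | n ≤ P.totalLen τ c u} ≤ K ^ c := by
    have := ENNReal.toReal_mono (ENNReal.pow_ne_top hK) h1
    rwa [ENNReal.toReal_mul, ENNReal.toReal_pow, ENNReal.toReal_pow,
      ENNReal.toReal_ofReal hs0.le] at this
  have h3 : K ^ c ≤ √s ^ n := by
    rw [← pow_le_pow_iff_left₀ (by positivity) (by positivity) two_ne_zero, ← pow_mul, ← pow_mul,
      mul_comm c, mul_comm n, pow_mul, pow_mul, Real.sq_sqrt hs0.le]
    refine (pow_le_pow_left₀ (by positivity) hq' c).trans ?_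
    rw [← pow_mul]
    exact pow_le_pow_right₀ hs1.le (Nat.mul_div_le n (q + 1))
  have h4 : s ^ n = √s ^ n * √s ^ n := by rw [← mul_pow, Real.mul_self_sqrt hs0.le]
  rw [one_mul, inv_pow]
  have hpos : 0 < √s ^ n := by positivity
  rw [h4, mul_assoc] at h2
  rw [← one_div, le_div_iff₀ hpos, mul_comm]
  exact le_of_mul_le_mul_left ((h2.trans h3).trans_eq (mul_one _).symm) hpos

lemma Ker.decaysExponentially_tail_absTheta (hLC : P.LocallyContinuous τ)
    {Ω : Type*} [MeasurableSpace Ω] {μ : Measure Ω} [IsProbabilityMeasure μ] {U : ℤ → Ω → ℝ}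
    (hU : IsIIDUniform μ U) (hgood : Ker.IsGood μ U P τ)
    (htail : DecaysExponentially (tail μ fun ω => P.absThetaBar τ fun i => U i ω)) {ρ : ℝ}
    (hρ0 : 0 < ρ) (hρ1 : ρ < 1) (hr : ∀ n, unifSeq.real (P.noBlockRenewal τ n) ≤ ρ ^ n) :
    DecaysExponentially (tail μ fun ω => absTheta (P.update τ) fun i => U i ω) := by
  have hfin := P.ae_depth_lt_top hU hgood
  obtain ⟨q, hq, hdec⟩ := P.exists_decaysExponentially_totalLen hfin
    (htail.mono fun n => (P.tail_absThetaBar_eq hU n).symm.le)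
  refine ((decaysExponentially_pow_div hρ0 hρ1 hq).add hdec).mono fun n => ?_
  have hm : MeasurableSet {u | n ≤ P.totalLen τ (n / q) u} :=
    P.measurable_totalLen _ (MeasurableSet.of_discrete (s := Set.Ici n))
  have hB := (P.measurableSet_noBlockRenewal' (τ := τ) (n / q)).union hm
  have h1 : tail μ (fun ω => absTheta (P.update τ) fun i => U i ω) n ≤
      unifSeq.real (P.noBlockRenewal τ (n / q) ∪ {u | n ≤ P.totalLen τ (n / q) u}) := by
    refine ENNReal.toReal_mono (measure_ne_top _ _) (hU.measure_le 0 hB ?_)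
    filter_upwards [hU.ae_backward 0 (P.ae_forall_depth_lt_top hfin)] with ω hω hn
    by_contra hnot
    rw [Set.mem_union, not_or] at hnot
    obtain ⟨l, hl, hcoal⟩ := P.exists_coalesces hLC hω hnot.1
    have : n ≤ l := by
      have hn' : (n : ℕ∞) ≤ absTheta (P.update τ) fun i => U i ω := hn
      exact_mod_cast hn'.trans hcoal.lag_le
    exact hnot.2 (this.trans hl.le)
  exact h1.trans ((measureReal_union_le _ _).trans (add_le_add (hr _) le_rfl))

end Tails

/-! ### The three regimes -/

section Regimes

variable {Ω : Type*} [MeasurableSpace Ω] {μ : Measure Ω} {U : ℤ → Ω → ℝ}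
  {A : Type*} [Encodable A] [Nonempty A] {P : Ker A} {τ : ContextTree A}

variable (P τ) in
/-- The probability that `n` successive blocks form a renewal: none of them demands more symbols
than there are older blocks among them. -/
noncomputable def Ker.renewalProb (n : ℕ) : ℝ :=
  ∏ j ∈ Finset.range n, unifSeq.real {u | P.demand τ u ≤ j}

omit [Nonempty A] in
lemma Ker.renewalProb_nonneg (n : ℕ) : 0 ≤ P.renewalProb τ n :=
  Finset.prod_nonneg fun _ _ => measureReal_nonneg

omit [Nonempty A] in
lemma Ker.renewalProb_sub_succ (n : ℕ) : P.renewalProb τ n - P.renewalProb τ (n + 1) =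
    P.renewalProb τ n * (1 - unifSeq.real {u | P.demand τ u ≤ n}) := by
  rw [renewalProb, renewalProb, Finset.prod_range_succ]
  ring

omit [Nonempty A] in
lemma Ker.renewalProb_le_one (n : ℕ) : P.renewalProb τ n ≤ 1 :=
  Finset.prod_le_one (fun _ _ => measureReal_nonneg) fun _ _ => measureReal_le_one

omit [Nonempty A] in
lemma Ker.seqA_nonneg (k : ℕ) : 0 ≤ Ker.seqA μ U P τ k :=
  (tsum_nonneg P.alpha_nonneg).trans (P.alphaMinusOne_le_seqA k)

lemma Ker.prod_seqA_le (hU : IsIIDUniform μ U) (hgood : Ker.IsGood μ U P τ) (n : ℕ) :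
    ∏ j ∈ Finset.range n, Ker.seqA μ U P τ j ≤ P.renewalProb τ n :=
  Finset.prod_le_prod (fun j _ => seqA_nonneg j) fun j _ => seqA_le hU hgood j

lemma Ker.sum_renewalProb_mul (hfin : ∀ᵐ u ∂unifSeq, P.depth τ u < ⊤) (n : ℕ) :
    ∑ m ∈ Finset.range (n + 1),
      P.renewalProb τ m * unifSeq.real (P.noBlockRenewal τ (n - m)) = 1 :=
  sum_mul_eq_one_of_renewal (r := fun n => unifSeq.real (P.noBlockRenewal τ n))
    (by simp [noBlockRenewal_zero]) (by simp)
    (P.measureReal_noBlockRenewal_succ hfin) n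

lemma Ker.tendsto_noBlockRenewal (hU : IsIIDUniform μ U) (hgood : Ker.IsGood μ U P τ)
    (h : Tendsto (fun n : ℕ => ∑ k ∈ Finset.Icc 1 n, ∏ j ∈ Finset.range k,
      Ker.seqA μ U P τ j) atTop atTop) :
    Tendsto (fun n => unifSeq.real (P.noBlockRenewal τ n)) atTop (𝓝 0) := by
  refine tendsto_zero_of_renewal (fun _ => measureReal_nonneg)
    (fun _ _ hmn => measureReal_mono (noRenewal_antitone _ hmn)) P.renewalProb_nonneg
    (P.sum_renewalProb_mul (P.ae_depth_lt_top hU hgood)) ?_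
  rw [← tendsto_add_atTop_iff_nat 1]
  refine tendsto_atTop_mono (fun n => ?_) h
  calc ∑ k ∈ Finset.Icc 1 n, ∏ j ∈ Finset.range k, Ker.seqA μ U P τ j
      ≤ ∑ k ∈ Finset.Icc 1 n, P.renewalProb τ k :=
        Finset.sum_le_sum fun k _ => prod_seqA_le hU hgood k
    _ ≤ ∑ k ∈ Finset.range (n + 1), P.renewalProb τ k :=
        Finset.sum_le_sum_of_subset_of_nonneg
          (fun k hk => Finset.mem_range.2 (by have := Finset.mem_Icc.1 hk; omega))
          fun k _ _ => P.renewalProb_nonneg k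

lemma Ker.exists_pos_le_renewalProb (hP : 0 < P.alphaMinusOne) (hU : IsIIDUniform μ U)
    (hgood : Ker.IsGood μ U P τ) (h : Summable fun k : ℕ => 1 - Ker.seqA μ U P τ k) :
    ∃ β > 0, ∀ n, β ≤ P.renewalProb τ n := by
  obtain ⟨β, hβ, hle⟩ := exists_pos_le_prod hP (fun k => P.alphaMinusOne_le_seqA k)
    (fun k => seqA_le_one k) h
  exact ⟨β, hβ, fun n => (hle n).trans (prod_seqA_le hU hgood n)⟩

lemma Ker.summable_noBlockRenewal (hP : 0 < P.alphaMinusOne) (hU : IsIIDUniform μ U)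
    (hgood : Ker.IsGood μ U P τ) (h : Summable fun k : ℕ => 1 - Ker.seqA μ U P τ k) :
    Summable fun n => unifSeq.real (P.noBlockRenewal τ n) := by
  obtain ⟨β, hβ, hle⟩ := exists_pos_le_renewalProb hP hU hgood h
  exact summable_of_renewal (fun _ => measureReal_nonneg) hβ hle
    (P.sum_renewalProb_mul (P.ae_depth_lt_top hU hgood))

lemma Ker.summable_one_sub_seqA (h : DecaysExponentially fun k => 1 - Ker.seqA μ U P τ k) :
    Summable fun k : ℕ => 1 - Ker.seqA μ U P τ k := by
  obtain ⟨D, d, -, hd0, hd1, hd⟩ := h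
  exact Summable.of_nonneg_of_le (fun k => sub_nonneg.2 (seqA_le_one k)) hd
    ((summable_geometric_of_lt_one hd0.le hd1).mul_left D)

lemma Ker.geometric_noBlockRenewal (hP : 0 < P.alphaMinusOne) (hU : IsIIDUniform μ U)
    (hgood : Ker.IsGood μ U P τ) (h : DecaysExponentially fun k => 1 - Ker.seqA μ U P τ k) :
    ∃ ρ : ℝ, 0 < ρ ∧ ρ < 1 ∧ ∀ n, unifSeq.real (P.noBlockRenewal τ n) ≤ ρ ^ n := by
  obtain ⟨β, hβ, hle⟩ := exists_pos_le_renewalProb hP hU hgood (summable_one_sub_seqA h)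
  obtain ⟨D, d, -, hd0, hd1, hd⟩ := h
  have hnonneg : ∀ n, 0 ≤ 1 - unifSeq.real {u | P.demand τ u ≤ (n : ℕ∞)} := fun n =>
    sub_nonneg.2 measureReal_le_one
  refine geometric_of_renewal (u := P.renewalProb τ) (by simp [noBlockRenewal_zero])
    (P.measureReal_noBlockRenewal_succ (P.ae_depth_lt_top hU hgood)) (by simp [renewalProb])
    (fun n => ?_) hβ hle hd0 hd1 (D := D) fun n => ?_
  · rw [renewalProb_sub_succ]
    exact mul_nonneg (P.renewalProb_nonneg n) (hnonneg n)
  · rw [renewalProb_sub_succ]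
    refine (mul_le_of_le_one_left (hnonneg n) (P.renewalProb_le_one n)).trans ?_
    exact (sub_le_sub_left (seqA_le hU hgood n) 1).trans (hd n)

end Regimes

end ChainsInfiniteOrder

theorem theorem1 {A : Type*} [Encodable A] [Nonempty A]
    {Ω : Type*} [MeasurableSpace Ω] (μ : Measure Ω) [IsProbabilityMeasure μ]
    (U : ℤ → Ω → ℝ) (hU : ChainsInfiniteOrder.IsIIDUniform μ U)
    (P : ChainsInfiniteOrder.Ker A) (hP : 0 < P.alphaMinusOne)
    (τ : ChainsInfiniteOrder.ContextTree A) (hτ : τ.IsSkeleton)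
    (hLC : P.LocallyContinuous τ)
    (hgood : ChainsInfiniteOrder.Ker.IsGood μ U P τ) :
    ∃ F : ChainsInfiniteOrder.Past A → ℝ → A,
      ChainsInfiniteOrder.IsUpdateFunction P F ∧
      -- regime (i)
      (Tendsto (fun n : ℕ => ∑ k ∈ Finset.Icc 1 n, ∏ j ∈ Finset.range k,
            ChainsInfiniteOrder.Ker.seqA μ U P τ j) atTop atTop →
        (∀ᵐ ω ∂μ, ChainsInfiniteOrder.absTheta F (fun i => U i ω) < ⊤) ∧
          ChainsInfiniteOrder.Feasible μ U F) ∧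
      -- regime (ii)
      (Summable (fun k : ℕ => 1 - ChainsInfiniteOrder.Ker.seqA μ U P τ k) →
        Summable (ChainsInfiniteOrder.tail μ
            (fun ω => ChainsInfiniteOrder.absTheta F (fun i => U i ω))) ∧
          ChainsInfiniteOrder.Feasible μ U F) ∧
      -- regime (iii)
      (ChainsInfiniteOrder.DecaysExponentially (ChainsInfiniteOrder.tail μ
            (fun ω => P.absThetaBar τ (fun i => U i ω))) →
        ChainsInfiniteOrder.DecaysExponentially
            (fun k : ℕ => 1 - ChainsInfiniteOrder.Ker.seqA μ U P τ k) →
        ChainsInfiniteOrder.DecaysExponentially (ChainsInfiniteOrder.tail μ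
            (fun ω => ChainsInfiniteOrder.absTheta F (fun i => U i ω))) ∧
          ChainsInfiniteOrder.Feasible μ U F) := by
  open ChainsInfiniteOrder in
  have feasible : Tendsto (fun n => unifSeq.real (P.noBlockRenewal τ n)) atTop (𝓝 0) →
      Feasible μ U (P.update τ) := fun hr =>
    Ker.feasible_of_ae_coalesces hU
      (P.ae_exists_coalesces hLC (P.ae_depth_lt_top hU hgood) hr)
  refine ⟨P.update τ, P.isUpdateFunction_update hLC, fun h => ?_, fun h => ?_, fun h1 h2 => ?_⟩
  · have hF := feasible (P.tendsto_noBlockRenewal hU hgood h)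
    exact ⟨hF 0 0 le_rfl, hF⟩
  · have hr := P.summable_noBlockRenewal hP hU hgood h
    exact ⟨P.summable_tail_absTheta hLC hU hgood hr, feasible hr.tendsto_atTop_zero⟩
  · obtain ⟨ρ, hρ0, hρ1, hρ⟩ := P.geometric_noBlockRenewal hP hU hgood h2
    exact ⟨P.decaysExponentially_tail_absTheta hLC hU hgood h1 hρ0 hρ1 hρ,
      feasible (P.summable_noBlockRenewal hP hU hgood
        (P.summable_one_sub_seqA h2)).tendsto_atTop_zero⟩
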